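/- Let $\sigma\in\{1,-1\}$ and consider the equation $$\partial_t u+\mathcal H_xu-\mathcal H_x\partial_x^2u+\sigma\,\mathcal H_x\partial_y^2u+u\,\partial_xu=0,\qquad (x,y)\in\mathbb R^2,\tag{1}$$ where $\mathcal H_x$ is the Hilbert transform in $x$, $\widehat{\mathcal H_x\phi}(\xi,\eta)=-i\,\mathrm{sign}(\xi)\,\widehat\phi(\xi,\eta)$. For $s,r_1,r_2>0$ let $$Z_{s,r_1,r_2}=H^s(\mathbb R^2)\cap L^2\big((|x|^{2r_1}+|y|^{2r_2})\,dx\,dy\big),$$ and let $W^{1,\infty}_x$ be the space with norm $\|f\|_{L^\infty}+\|\partial_xf\|_{L^\infty}$. Theorem. Let $r_1\in(1/4,1/2)$, $r_2\ge r_1$, $s>\frac{2r_1}{4r_1-1}$ and $s\ge r_2$. Let $u$ be a (real- or complex-valued) solution of (1) on $[0,T]$, in the sense of tempered distributions in $(x,y)$ with $u\,\partial_xu=\tfrac12\partial_x(u^2)$, such that $$u\in C([0,T];Z_{s,r_1,r_2})\cap L^1([0,T];W^{1,\infty}_x).$$ Let $t_1\in[0,T]$ be such that $u(\cdot,t_1)\in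 Z_{s,\frac12+\varepsilon,r_2}$ for some $\varepsilon>0$. If there is a time $t_2\in(t_1,T]$ with $u(\cdot,t_2)\in Z_{s,\frac12,r_2}$, then for every $t\in[t_1,T]$ $$\widehat u(0,\eta,t)=0\quad\text{for almost every }\eta\in\mathbb R .$$ Here $\widehat u(0,\eta,t)=0$ for a.e. $\eta$ means that the Fourier transform $\widehat u(\cdot,\cdot,t)\in L^2(\mathbb R^2)$ has a representative which for almost every $\eta$ is continuous in $\xi\in\mathbb R$ and vanishes at $\xi=0$. In particular, if it is not the case that $\widehat u(0,\eta,t_1)=0$ for almost every $\eta$, then $u(\cdot,t_2)\notin Z_{s,\frac12,r_2}$ for every $t_2\in(t_1,T]$. -/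

import Mathlib

open MeasureTheory Filter Topology Set FourierTransform
open scoped ENNReal SchwartzMap LineDeriv

namespace CapillaryGravity

noncomputable section

/-- The Euclidean plane; a point `z` has coordinates `x = z 0` and `y = z 1`, a frequency `ζ` has
coordinates `ξ = ζ 0` and `η = ζ 1`. -/
abbrev Plane : Type := EuclideanSpace ℝ (Fin 2)

/-- Complex-valued square-integrable functions on the plane. Their Fourier transform `𝓕` is
Mathlib's, with kernel `exp (-2πi z·ζ)`; the frequency variable is thus the usual one
divided by `2π`. -/
abbrev L2 : Type := Lp ℂ 2 (volume : Measure Plane)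

/-- The unit vector in the `x` direction. -/
def ex : Plane := EuclideanSpace.single 0 1

/-- The unit vector in the `y` direction. -/
def ey : Plane := EuclideanSpace.single 1 1

/-- The symbol `-i sign ξ` of the Hilbert transform in the `x` direction. -/
def hilbertSymbol (ζ : Plane) : ℂ := -Complex.I * ((SignType.sign (ζ 0) : ℝ) : ℂ)

theorem memLp_hilbertSymbol_mul (f : L2) :
    MemLp (fun ζ : Plane ↦ hilbertSymbol ζ * f ζ) 2 volume := by
  have hm : Measurable hilbertSymbol := by
    have h0 : Measurable (fun ζ : Plane ↦ ζ 0) := by fun_prop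
    have hs : Measurable (fun x : ℝ ↦ ((SignType.sign x : SignType) : ℝ)) := by
      have : (fun x : ℝ ↦ ((SignType.sign x : SignType) : ℝ))
          = fun x ↦ if 0 < x then 1 else if x < 0 then -1 else 0 := by
        funext x
        rcases lt_trichotomy x 0 with h | h | h
        · simp [h, not_lt.mpr h.le]
        · simp [h]
        · simp [h]
      rw [this]
      exact Measurable.ite measurableSet_Ioi measurable_const
        (Measurable.ite measurableSet_Iio measurable_const measurable_const)
    exact measurable_const.mul (Complex.measurable_ofReal.comp (hs.comp h0))
  refine (Lp.memLp f).of_le (hm.aestronglyMeasurable.mul (Lp.aestronglyMeasurable f)) ?_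
  refine Eventually.of_forall fun ζ ↦ ?_
  rw [norm_mul]
  refine mul_le_of_le_one_left (norm_nonneg _) ?_
  simp only [hilbertSymbol, norm_mul, norm_neg, Complex.norm_I, one_mul, Complex.norm_real]
  rcases lt_trichotomy (ζ 0) 0 with h | h | h <;> simp [h]

/-- The Hilbert transform in the `x` direction on `L²`. -/
def hilbertX (f : L2) : L2 := 𝓕⁻ ((memLp_hilbertSymbol_mul (𝓕 f)).toLp _)

theorem memLp_sq (f : L2) : MemLp (fun z : Plane ↦ f z ^ 2) 1 volume := by
  have h : MemLp (⇑f * ⇑f) 1 volume :=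
    (Lp.memLp f).mul (p := 2) (q := 2) (r := 1) (Lp.memLp f)
  refine h.ae_eq (Eventually.of_forall fun z ↦ ?_)
  simp [pow_two]

/-- The square `f²` of an `L²` function, as an `L¹` function. -/
def square (f : L2) : Lp ℂ 1 (volume : Measure Plane) := (memLp_sq f).toLp _

/-- The tempered distribution `H f - H ∂ₓ² f + σ H ∂ᵧ² f + f ∂ₓ f`, with `H` the Hilbert transform
in `x`; the nonlinear term is read as `(1/2) ∂ₓ (f²)`. -/
def spatialPart (σ : ℝ) (f : L2) : 𝓢'(Plane, ℂ) :=
  (hilbertX f : 𝓢'(Plane, ℂ)) - ∂_{ex} (∂_{ex} (hilbertX f : 𝓢'(Plane, ℂ)))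
    + (σ : ℂ) • ∂_{ey} (∂_{ey} (hilbertX f : 𝓢'(Plane, ℂ)))
    + (1 / 2 : ℂ) • ∂_{ex} (square f : 𝓢'(Plane, ℂ))

/-- `u` solves `∂ₜ u + H u - H ∂ₓ² u + σ H ∂ᵧ² u + u ∂ₓ u = 0` on the time interval `[0, T]`, in the
sense of tempered distributions in `(x, y)`. -/
def IsSolution (σ T : ℝ) (u : ℝ → L2) : Prop :=
  ∀ ψ : 𝓢(Plane, ℂ), ∀ t ∈ Icc (0 : ℝ) T,
    HasDerivWithinAt (fun τ ↦ (u τ : 𝓢'(Plane, ℂ)) ψ) (-(spatialPart σ (u t) ψ)) (Icc 0 T) t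

/-- The norm of the Sobolev space `H^s` (Bessel potential norm), with value `∞` off the space. -/
def sobolevENorm (s : ℝ) (f : L2) : ℝ≥0∞ :=
  eLpNorm (fun ζ : Plane ↦ ((1 + ‖ζ‖ ^ 2) ^ (s / 2) : ℝ) • (𝓕 f : L2) ζ) 2 volume

/-- The norm of `L²((|x|^{2 r₁} + |y|^{2 r₂}) dx dy)`, with value `∞` off the space. -/
def weightedENorm (r₁ r₂ : ℝ) (f : L2) : ℝ≥0∞ :=
  eLpNorm (fun z : Plane ↦ √(|z 0| ^ (2 * r₁) + |z 1| ^ (2 * r₂)) • f z) 2 volume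

/-- The norm of `Z_{s,r₁,r₂} = H^s ∩ L²((|x|^{2 r₁} + |y|^{2 r₂}) dx dy)`. -/
def zENorm (s r₁ r₂ : ℝ) (f : L2) : ℝ≥0∞ := sobolevENorm s f + weightedENorm r₁ r₂ f

/-- Membership in `Z_{s,r₁,r₂}`. -/
def MemZ (s r₁ r₂ : ℝ) (f : L2) : Prop := zENorm s r₁ r₂ f < ∞

/-- `u ∈ C([0, T]; Z_{s,r₁,r₂})`. -/
def ContinuousInZ (s r₁ r₂ T : ℝ) (u : ℝ → L2) : Prop :=
  (∀ t ∈ Icc (0 : ℝ) T, MemZ s r₁ r₂ (u t)) ∧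
    ∀ t₀ ∈ Icc (0 : ℝ) T,
      Tendsto (fun t ↦ zENorm s r₁ r₂ (u t - u t₀)) (𝓝[Icc 0 T] t₀) (𝓝 0)

/-- The norm `‖f‖_∞ + ‖∂ₓ f‖_∞` of `W^{1,∞}_x`, where `∂ₓ f` is the distributional derivative; the
value is `∞` if `∂ₓ f` is not an essentially bounded function. -/
def w1infENorm (f : L2) : ℝ≥0∞ :=
  ⨅ (g : Lp ℂ ∞ (volume : Measure Plane))
    (_ : ∂_{ex} (f : 𝓢'(Plane, ℂ)) = (g : 𝓢'(Plane, ℂ))),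
      eLpNorm f ∞ volume + eLpNorm g ∞ volume

/-- `u ∈ L¹([0, T]; W^{1,∞}_x)`. -/
def MemL1W (T : ℝ) (u : ℝ → L2) : Prop := ∫⁻ t in Icc (0 : ℝ) T, w1infENorm (u t) < ∞

/-- `f̂(0, η) = 0` for almost every `η`: the Fourier transform of `f` has a representative which,
for almost every `η`, is continuous in `ξ` and vanishes at `ξ = 0`. (Two representatives that are
continuous in `ξ` for almost every `η` agree at `(0, η)` for almost every `η`.) -/
def FourierVanishesAtZero (f : L2) : Prop :=
  ∃ g : ℝ → ℝ → ℂ, (∀ᵐ ζ : Plane, (𝓕 f : L2) ζ = g (ζ 0) (ζ 1)) ∧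
    ∀ᵐ η : ℝ, Continuous (fun ξ ↦ g ξ η) ∧ g 0 η = 0

end

end CapillaryGravity

namespace CapillaryGravity

noncomputable section

open BoundedContinuousFunction

/-! The argument takes place on the Fourier side. There the linear part is multiplication by `i *
dispersion`, where `dispersion` is odd in `ξ` and jumps across `ξ = 0`. Duhamel's formula
(`duhamel`) expresses `û(t)` as `exp (i (t - t₁) dispersion) û(t₁)` plus a nonlinear term carrying a
factor `ξ`. Since `u²` is in `L¹`, its transform is bounded and continuous, so the nonlinear term
vanishes at `ξ = 0`.

Decay of order `1/2 + ε` in `x` at time `t₁` gives a representative `G` of `û(t₁)` that is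
continuous in `ξ` (`exists_continuous_representative`): `û(t₁)` is a convolution in `ξ` of an `L²`
function with a gamma density, which is itself in `L²` when its exponent exceeds `1/2`. Hence
`û(t₂)` has one-sided limits `exp (± i θ) G(0, η)` at `ξ = 0`, with `θ = (t₂ - t₁)(1 - 4π²ση²)`, and
its jump is `2i sin θ · G(0, η)`.

Decay of order exactly `1/2` at time `t₂` excludes such jumps (`ae_eq_of_tendsto_fourier`): `h⁻¹
‖û(· + h) - û‖²` tends to `0` along `h = 1/(n+1)`, whereas a jump keeps it bounded below. As `sin θ
≠ 0` for almost every `η`, `G(0, η) = 0` almost everywhere. With this value the two branches of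
Duhamel's formula, for `ξ > 0` and `ξ < 0`, glue continuously with value `0` at every `t ≥ t₁`. -/

/-! ### Coordinates on the plane -/

/-- The identification of the plane with `ℝ × ℝ`. -/
def xy : Plane ≃ᵐ ℝ × ℝ :=
  (MeasurableEquiv.toLp 2 (Fin 2 → ℝ)).symm.trans MeasurableEquiv.finTwoArrow

theorem xy_apply (z : Plane) : xy z = (z 0, z 1) := rfl

theorem xy_symm_zero (p : ℝ × ℝ) : xy.symm p 0 = p.1 := by
  have := congrArg Prod.fst (xy.apply_symm_apply p); rwa [xy_apply] at this

theorem xy_symm_one (p : ℝ × ℝ) : xy.symm p 1 = p.2 := by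
  have := congrArg Prod.snd (xy.apply_symm_apply p); rwa [xy_apply] at this

theorem measurePreserving_xy : MeasurePreserving xy :=
  (volume_preserving_finTwoArrow ℝ).comp
    (EuclideanSpace.volume_preserving_symm_measurableEquiv_toLp (Fin 2))

@[simp] theorem ex_zero : ex 0 = 1 := by simp [ex]
@[simp] theorem ex_one : ex 1 = 0 := by simp [ex]

theorem inner_ex (z : Plane) : inner ℝ z ex = z 0 := by
  simp [ex, EuclideanSpace.inner_single_right]

theorem inner_ey (z : Plane) : inner ℝ z ey = z 1 := by
  simp [ey, EuclideanSpace.inner_single_right]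

theorem xy_symm_add_smul_ex (ξ η h : ℝ) : xy.symm (ξ, η) + h • ex = xy.symm (ξ + h, η) := by
  apply xy.injective
  simp [xy_apply, xy_symm_zero, xy_symm_one]

theorem ae_ae_of_ae_plane {p : Plane → Prop} (h : ∀ᵐ ζ, p ζ) :
    ∀ᵐ η : ℝ, ∀ᵐ ξ : ℝ, p (xy.symm (ξ, η)) := by
  have h1 : ∀ᵐ q : ℝ × ℝ, p (xy.symm q) :=
    (measurePreserving_xy.symm xy).quasiMeasurePreserving.ae h
  -- The swap makes `η` the outer variable.
  have h2 : ∀ᵐ q : ℝ × ℝ, p (xy.symm q.swap) :=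
    (Measure.measurePreserving_swap (μ := (volume : Measure ℝ))
      (ν := (volume : Measure ℝ))).quasiMeasurePreserving.ae h1
  exact Measure.ae_ae_of_ae_prod h2

theorem ae_plane_of_ae_zero {p : ℝ → Prop} (h : ∀ᵐ ξ, p ξ) : ∀ᵐ ζ : Plane, p (ζ 0) := by
  have h1 : ∀ᵐ q : ℝ × ℝ, p q.1 := Measure.quasiMeasurePreserving_fst.ae h
  exact measurePreserving_xy.quasiMeasurePreserving.ae h1

theorem lintegral_plane {f : Plane → ℝ≥0∞} (hf : Measurable f) :
    ∫⁻ ζ, f ζ = ∫⁻ η : ℝ, ∫⁻ ξ : ℝ, f (xy.symm (ξ, η)) := by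
  rw [← (measurePreserving_xy.symm xy).lintegral_comp hf, Measure.volume_eq_prod,
    lintegral_prod_symm' (fun a ↦ f (xy.symm a)) (hf.comp xy.symm.measurable)]

/-! ### The Fourier transform on `L²`, tested against Schwartz functions -/

theorem integral_mul_fourier (f : L2) (φ : 𝓢(Plane, ℂ)) :
    ∫ ζ, φ ζ * (𝓕 f : L2) ζ = ∫ z, (𝓕 φ) z * f z := by
  have h := congrArg (fun T : 𝓢'(Plane, ℂ) ↦ T φ) (Lp.fourier_toTemperedDistribution_eq f)
  simpa using h.symm

/-- The fundamental lemma of the calculus of variations, tested on real bump functions. Restricting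
to compact support allows `F` and `G` to be merely locally integrable. -/
theorem ae_eq_of_forall_integral_mul_eq {F G : Plane → ℂ} (hF : LocallyIntegrable F)
    (hG : LocallyIntegrable G)
    (h : ∀ φ : 𝓢(Plane, ℂ), HasCompactSupport φ → ∫ z, φ z * F z = ∫ z, φ z * G z) :
    F =ᵐ[volume] G := by
  have := ae_eq_zero_of_integral_contDiff_smul_eq_zero (μ := volume) (f := F - G) (hF.sub hG) ?_
  · filter_upwards [this] with z hz
    exact sub_eq_zero.1 hz
  intro g hg hgc
  have hg₁ : HasCompactSupport (Complex.ofRealCLM ∘ g) := hgc.comp_left rfl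
  have hg₂ : ContDiff ℝ (⊤ : ℕ∞) (Complex.ofRealCLM ∘ g) :=
    Complex.ofRealCLM.contDiff.comp hg
  have h1 := h (hg₁.toSchwartzMap hg₂) hg₁
  have i1 := hF.integrable_smul_left_of_hasCompactSupport hg.continuous hgc
  have i2 := hG.integrable_smul_left_of_hasCompactSupport hg.continuous hgc
  have e : (fun x ↦ g x • (F - G) x) = fun x ↦ g x • F x - g x • G x := by
    ext x; simp [mul_sub]
  rw [e, integral_sub i1 i2, sub_eq_zero]
  simpa using h1

theorem locallyIntegrable_L2 (f : L2) : LocallyIntegrable f :=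
  (Lp.memLp f).locallyIntegrable (by norm_num)

/-- Modulation by `exp (2πi v·z)` translates the Fourier transform by `v`. -/
theorem fourier_modulation (f k : L2) (v : Plane)
    (h : ∀ᵐ z, k z = Complex.exp (2 * Real.pi * Complex.I * (inner ℝ z v : ℝ)) * f z) :
    ∀ᵐ ζ, (𝓕 k : L2) ζ = (𝓕 f : L2) (ζ - v) := by
  have hmp : MeasurePreserving (fun ζ : Plane ↦ ζ - v) := measurePreserving_sub_right _ v
  have hmem : MemLp (fun ζ ↦ (𝓕 f : L2) (ζ - v)) 2 :=
    (Lp.memLp (𝓕 f : L2)).comp_measurePreserving hmp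
  refine ae_eq_of_forall_integral_mul_eq (locallyIntegrable_L2 _)
    (hmem.locallyIntegrable (by norm_num)) fun φ _ ↦ ?_
  -- By duality the modulation moves to the test function: `φ'` is `φ (· + v)`, whose transform is
  -- the modulated `𝓕 φ`.
  set φ' : 𝓢(Plane, ℂ) := φ.compSubConstCLM ℂ (-v)
  have h1 : ∀ z, (𝓕 φ') z
      = Complex.exp (2 * Real.pi * Complex.I * (inner ℝ z v : ℝ)) * (𝓕 φ) z := by
    intro z
    rw [SchwartzMap.fourier_coe, SchwartzMap.fourier_coe, Real.fourier_eq', Real.fourier_eq',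
      ← integral_const_mul, ← integral_sub_right_eq_self _ v]
    refine integral_congr_ae (Eventually.of_forall fun w ↦ ?_)
    simp only [φ', SchwartzMap.compSubConstCLM_apply, smul_eq_mul, ← mul_assoc, ← Complex.exp_add]
    rw [real_inner_comm v z, sub_neg_eq_add, sub_add_cancel, inner_sub_left]
    congr 2
    push_cast
    ring
  calc ∫ ζ, φ ζ * (𝓕 k : L2) ζ = ∫ z, (𝓕 φ) z * k z := integral_mul_fourier k φ
    _ = ∫ z, (𝓕 φ') z * f z := by
        refine integral_congr_ae ?_
        filter_upwards [h] with z hz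
        rw [hz, h1]; ring
    _ = ∫ ζ, φ' ζ * (𝓕 f : L2) ζ := (integral_mul_fourier f φ').symm
    _ = ∫ ζ, φ ζ * (𝓕 f : L2) (ζ - v) := by
        rw [← integral_sub_right_eq_self _ v]
        simp [φ']

/-! ### The equation on the Fourier side -/

/-- The dispersion relation of the linear part of the equation. -/
def dispersion (σ ξ η : ℝ) : ℝ :=
  (SignType.sign ξ : ℝ) * (1 + 4 * Real.pi ^ 2 * ξ ^ 2 - 4 * Real.pi ^ 2 * σ * η ^ 2)

/-- The Fourier transform of `f²`, a bounded continuous function. -/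
def squareHat (f : L2) : Plane →ᵇ ℂ := Real.Lp.fourierTransformCLM Plane ℂ (square f)

/-- Exhibits squaring as a bounded bilinear map `L² × L² → L¹` on the diagonal, whence the
continuity of `squareHat`. -/
theorem square_eq_holder (f : L2) :
    square f = (ContinuousLinearMap.mul ℂ ℂ).holderL (volume : Measure Plane) 2 2 1 f f := by
  rw [ContinuousLinearMap.holderL_apply_apply]
  exact MemLp.toLp_congr _ _ (Eventually.of_forall fun z ↦ by simp [pow_two])

theorem continuous_squareHat : Continuous squareHat := by
  have : squareHat = fun f ↦ Real.Lp.fourierTransformCLM Plane ℂ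
      ((ContinuousLinearMap.mul ℂ ℂ).holderL (volume : Measure Plane) 2 2 1 f f) :=
    funext fun f ↦ by rw [squareHat, square_eq_holder]
  rw [this]
  fun_prop

theorem integral_mul_squareHat (f : L2) (φ : 𝓢(Plane, ℂ)) :
    ∫ ζ, φ ζ * squareHat f ζ = Lp.toTemperedDistribution (square f) (𝓕 φ) := by
  have h := VectorFourier.integral_fourierIntegral_smul_eq_flip (μ := (volume : Measure Plane))
    (ν := (volume : Measure Plane)) (L := innerₗ Plane)
    (f := φ) (g := square f) Real.continuous_fourierChar continuous_inner φ.integrable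
    (L1.integrable_coeFn (square f))
  rw [Lp.toTemperedDistribution_apply]
  refine Eq.trans ?_ h.symm
  rw [flip_innerₗ]
  rfl

theorem fourier_hilbertX (f : L2) :
    ∀ᵐ ζ, (𝓕 (hilbertX f) : L2) ζ = hilbertSymbol ζ * (𝓕 f : L2) ζ := by
  rw [hilbertX, FourierTransform.fourier_fourierInv_eq]
  exact MemLp.coeFn_toLp _

theorem hilbertX_apply_fourier (f : L2) (φ : 𝓢(Plane, ℂ)) :
    (hilbertX f : 𝓢'(Plane, ℂ)) (𝓕 φ) = ∫ ζ, φ ζ * (hilbertSymbol ζ * (𝓕 f : L2) ζ) := by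
  rw [Lp.toTemperedDistribution_apply]
  simp only [smul_eq_mul]
  rw [← integral_mul_fourier]
  refine integral_congr_ae ?_
  filter_upwards [fourier_hilbertX f] with ζ hζ
  rw [hζ]

/-- Two signs cancel: one from the duality defining the distributional derivative, one from
differentiating a Fourier transform. -/
theorem lineDerivOp_apply_fourier (S : 𝓢'(Plane, ℂ)) (v : Plane) (φ : 𝓢(Plane, ℂ)) :
    (∂_{v} S) (𝓕 φ) = S (𝓕 ((2 * Real.pi * Complex.I) •
      SchwartzMap.smulLeftCLM ℂ (inner ℝ · v : Plane → ℝ) φ)) := by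
  rw [TemperedDistribution.lineDerivOp_apply_apply, SchwartzMap.lineDerivOp_fourier_eq]
  congr 1
  rw [neg_smul, FourierTransform.fourier_neg, neg_neg]

/-- Testing against `𝓕 φ` replaces each operator by its symbol: `∂ₓ` becomes `2πiξ`, so `(1/2) ∂ₓ`
gives `πiξ`, and the three Hilbert terms combine into `-i * dispersion`. -/
theorem spatialPart_apply_fourier (σ : ℝ) (f : L2) (φ : 𝓢(Plane, ℂ)) :
    spatialPart σ f (𝓕 φ)
      = ∫ ζ, φ ζ * (-Complex.I * dispersion σ (ζ 0) (ζ 1) * (𝓕 f : L2) ζ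
        + Real.pi * Complex.I * ζ 0 * squareHat f ζ) := by
  have hx : (fun z : Plane ↦ (inner ℝ z ex : ℝ)).HasTemperateGrowth := by fun_prop
  have hy : (fun z : Plane ↦ (inner ℝ z ey : ℝ)).HasTemperateGrowth := by fun_prop
  have hX : ∀ (ψ : 𝓢(Plane, ℂ)) (ζ : Plane),
      SchwartzMap.smulLeftCLM ℂ (fun z : Plane ↦ (inner ℝ z ex : ℝ)) ψ ζ = (ζ 0 : ℂ) * ψ ζ :=
    fun ψ ζ ↦ by rw [SchwartzMap.smulLeftCLM_apply_apply hx, inner_ex, Complex.real_smul]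
  have hY : ∀ (ψ : 𝓢(Plane, ℂ)) (ζ : Plane),
      SchwartzMap.smulLeftCLM ℂ (fun z : Plane ↦ (inner ℝ z ey : ℝ)) ψ ζ = (ζ 1 : ℂ) * ψ ζ :=
    fun ψ ζ ↦ by rw [SchwartzMap.smulLeftCLM_apply_apply hy, inner_ey, Complex.real_smul]
  have key : spatialPart σ f (𝓕 φ) = (hilbertX f : 𝓢'(Plane, ℂ)) (𝓕 φ)
      - (∂_{ex} (∂_{ex} (hilbertX f : 𝓢'(Plane, ℂ)))) (𝓕 φ)
      + (σ : ℂ) * (∂_{ey} (∂_{ey} (hilbertX f : 𝓢'(Plane, ℂ)))) (𝓕 φ)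
      + (1 / 2 : ℂ) * (∂_{ex} (square f : 𝓢'(Plane, ℂ))) (𝓕 φ) := rfl
  rw [key]
  simp only [lineDerivOp_apply_fourier, hilbertX_apply_fourier, ← integral_mul_squareHat]
  have hF : ∀ ψ : 𝓢(Plane, ℂ), Integrable fun ζ ↦ ψ ζ * (hilbertSymbol ζ * (𝓕 f : L2) ζ) :=
    fun ψ ↦ (ψ.memLp 2).integrable_mul (memLp_hilbertSymbol_mul (𝓕 f))
  have hQ : ∀ ψ : 𝓢(Plane, ℂ), Integrable fun ζ ↦ ψ ζ * squareHat f ζ := fun ψ ↦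
    ψ.integrable.mul_bdd (squareHat f).continuous.aestronglyMeasurable
      (Eventually.of_forall fun ζ ↦ (squareHat f).norm_coe_le_norm ζ)
  have comb : ∀ {A B C D : Plane → ℂ} (c d : ℂ), Integrable A → Integrable B → Integrable C →
      Integrable D → (∫ z, A z) - (∫ z, B z) + c * (∫ z, C z) + d * (∫ z, D z)
        = ∫ z, (A z - B z + c * C z + d * D z) := by
    intro A B C D c d hA hB hC hD
    rw [integral_add (f := fun z ↦ A z - B z + c * C z)
        ((hA.sub hB).add (hC.const_mul c)) (hD.const_mul d),
      integral_add (f := fun z ↦ A z - B z) (hA.sub hB) (hC.const_mul c), integral_sub hA hB,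
      integral_const_mul, integral_const_mul]
  rw [comb _ _ (hF _) (hF _) (hF _) (hQ _)]
  refine integral_congr_ae (Eventually.of_forall fun ζ ↦ ?_)
  simp only [hX, hY, _root_.smul_apply, smul_eq_mul, hilbertSymbol, dispersion]
  push_cast
  ring_nf
  simp only [Complex.I_pow_three]
  ring

/-! ### Duhamel's formula -/

/-- The `L²` pairing `∫ f g`. -/
def pairing : L2 →L[ℂ] L2 →L[ℂ] ℂ := (ContinuousLinearMap.mul ℂ ℂ).lpPairing volume 2 2

theorem pairing_toLp (φ : 𝓢(Plane, ℂ)) (f : L2) :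
    pairing (φ.toLp 2) f = ∫ ζ, φ ζ * f ζ := by
  rw [pairing, ContinuousLinearMap.lpPairing_eq_integral]
  refine integral_congr_ae ?_
  filter_upwards [φ.coeFn_toLp 2 volume] with ζ hζ
  simp [hζ]

theorem pairing_fourier (φ : 𝓢(Plane, ℂ)) (f : L2) :
    pairing (φ.toLp 2) (𝓕 f) = (f : 𝓢'(Plane, ℂ)) (𝓕 φ) := by
  rw [pairing_toLp, integral_mul_fourier, Lp.toTemperedDistribution_apply]
  rfl

/-- The function `exp (-itP) g`, for smooth `P` and smooth compactly supported `g`. -/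
def twist {P : Plane → ℝ} {g : Plane → ℂ} (hP : ContDiff ℝ (⊤ : ℕ∞) P)
    (hg : ContDiff ℝ (⊤ : ℕ∞) g) (hgc : HasCompactSupport g) (t : ℝ) : 𝓢(Plane, ℂ) :=
  HasCompactSupport.toSchwartzMap (f := fun ζ ↦ Complex.exp (-Complex.I * (t * P ζ : ℝ)) * g ζ)
    hgc.mul_left
    ((contDiff_const.mul (Complex.ofRealCLM.contDiff.comp (contDiff_const.mul hP))).cexp.mul hg)

section twist

variable {P : Plane → ℝ} {g : Plane → ℂ} (hP : ContDiff ℝ (⊤ : ℕ∞) P)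
  (hg : ContDiff ℝ (⊤ : ℕ∞) g) (hgc : HasCompactSupport g)

theorem twist_apply (t : ℝ) (ζ : Plane) :
    twist hP hg hgc t ζ = Complex.exp (-Complex.I * (t * P ζ : ℝ)) * g ζ := rfl

theorem norm_exp_neg_I_mul (x : ℝ) : ‖Complex.exp (-Complex.I * x)‖ = 1 := by
  simp [Complex.norm_exp]

theorem norm_exp_neg_I_mul_sub_le (x y : ℝ) :
    ‖Complex.exp (-Complex.I * x) - Complex.exp (-Complex.I * y)‖ ≤ |x - y| := by
  have h : Complex.exp (-Complex.I * x) - Complex.exp (-Complex.I * y)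
      = Complex.exp (-Complex.I * y) * (Complex.exp (Complex.I * ((y - x : ℝ) : ℂ)) - 1) := by
    rw [mul_sub, ← Complex.exp_add, mul_one]
    congr 2
    push_cast; ring
  rw [h, norm_mul, norm_exp_neg_I_mul, one_mul, abs_sub_comm]
  exact Real.norm_exp_I_mul_ofReal_sub_one_le

/-- The phase is Lipschitz in time with constant `|P ζ|`, and `P g` is in `L²` because `g` has
compact support. -/
theorem exists_norm_twist_sub_le :
    ∃ C, ∀ t s, ‖(twist hP hg hgc t).toLp 2 volume - (twist hP hg hgc s).toLp 2 volume‖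
      ≤ C * |t - s| := by
  have hk : MemLp (fun ζ ↦ (P ζ : ℂ) * g ζ) 2 (volume : Measure Plane) :=
    ((Complex.continuous_ofReal.comp hP.continuous).mul hg.continuous).memLp_of_hasCompactSupport
      hgc.mul_left
  refine ⟨‖hk.toLp‖, fun t s ↦ ?_⟩
  rw [mul_comm]
  refine Lp.norm_le_mul_norm_of_ae_le_mul ?_
  filter_upwards [hk.coeFn_toLp, (twist hP hg hgc t).coeFn_toLp 2 volume,
    (twist hP hg hgc s).coeFn_toLp 2 volume, Lp.coeFn_sub ((twist hP hg hgc t).toLp 2 volume)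
      ((twist hP hg hgc s).toLp 2 volume)] with ζ h1 h2 h3 h4
  rw [h4, Pi.sub_apply, h1, h2, h3, twist_apply, twist_apply, ← sub_mul, norm_mul, norm_mul,
    ← mul_assoc]
  refine mul_le_mul_of_nonneg_right ?_ (norm_nonneg _)
  refine (norm_exp_neg_I_mul_sub_le _ _).trans_eq ?_
  rw [← sub_mul, abs_mul, Complex.norm_real, Real.norm_eq_abs]

theorem hasDerivAt_pairing_twist (f : L2) (t : ℝ) :
    HasDerivAt (fun τ ↦ pairing ((twist hP hg hgc τ).toLp 2) f)
      (∫ ζ, twist hP hg hgc t ζ * (-Complex.I * P ζ * f ζ)) t := by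
  simp only [pairing_toLp]
  have hk : MemLp (fun ζ ↦ (P ζ : ℂ) * g ζ) 2 (volume : Measure Plane) :=
    ((Complex.continuous_ofReal.comp hP.continuous).mul hg.continuous).memLp_of_hasCompactSupport
      hgc.mul_left
  have hi : Integrable (fun ζ ↦ (P ζ : ℂ) * g ζ * f ζ) := hk.integrable_mul (Lp.memLp f)
  refine (hasDerivAt_integral_of_dominated_loc_of_deriv_le (s := univ)
    (F := fun τ ζ ↦ twist hP hg hgc τ ζ * f ζ) (x₀ := t)
    (F' := fun τ ζ ↦ twist hP hg hgc τ ζ * (-Complex.I * P ζ * f ζ))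
    (bound := fun ζ ↦ ‖(P ζ : ℂ) * g ζ * f ζ‖) univ_mem ?_ ?_ ?_ ?_ hi.norm ?_).2
  · exact Eventually.of_forall fun τ ↦
      (twist hP hg hgc τ).continuous.aestronglyMeasurable.mul (Lp.aestronglyMeasurable f)
  · exact ((twist hP hg hgc t).memLp 2).integrable_mul (Lp.memLp f)
  · refine (twist hP hg hgc t).continuous.aestronglyMeasurable.mul
      (Continuous.aestronglyMeasurable ?_ |>.mul (Lp.aestronglyMeasurable f))
    exact continuous_const.mul (Complex.continuous_ofReal.comp hP.continuous)
  · refine Eventually.of_forall fun ζ τ _ ↦ le_of_eq ?_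
    simp only [twist_apply, norm_mul, norm_exp_neg_I_mul, norm_neg, Complex.norm_I]
    ring
  · refine Eventually.of_forall fun ζ τ _ ↦ ?_
    have h1 : HasDerivAt (fun τ : ℝ ↦ -Complex.I * ((τ * P ζ : ℝ) : ℂ)) (-Complex.I * P ζ) τ := by
      have := ((hasDerivAt_id τ).mul_const (P ζ)).ofReal_comp.const_mul (-Complex.I)
      simpa using this
    have h2 := (h1.cexp.mul_const (g ζ)).mul_const (f ζ)
    refine h2.congr_deriv ?_
    rw [twist_apply]; ring

end twist

/-- The integrating factor `exp (-itP)` cancels the linear part, since `P` is the dispersion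
relation wherever `g ≠ 0`. Only the nonlinear term survives. -/
theorem hasDerivWithinAt_pairing_twist {σ T : ℝ} {u : ℝ → L2} (hsol : IsSolution σ T u)
    (hu : ContinuousOn u (Icc 0 T)) {P : Plane → ℝ} {g : Plane → ℂ} (hP : ContDiff ℝ (⊤ : ℕ∞) P)
    (hg : ContDiff ℝ (⊤ : ℕ∞) g) (hgc : HasCompactSupport g)
    (hPg : ∀ ζ, g ζ ≠ 0 → dispersion σ (ζ 0) (ζ 1) = P ζ) {t : ℝ} (ht : t ∈ Icc 0 T) :
    HasDerivWithinAt (fun τ ↦ pairing ((twist hP hg hgc τ).toLp 2) (𝓕 (u τ)))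
      (∫ ζ, twist hP hg hgc t ζ * (-(Real.pi * Complex.I * ζ 0 * squareHat (u t) ζ)))
      (Icc 0 T) t := by
  set Φ := fun τ ↦ (twist hP hg hgc τ).toLp 2 (volume : Measure Plane)
  have h1 : HasDerivWithinAt (fun τ ↦ pairing (Φ t) (𝓕 (u τ)))
      (-(spatialPart σ (u t) (𝓕 (twist hP hg hgc t)))) (Icc 0 T) t := by
    simp only [Φ, pairing_fourier]
    exact hsol _ t ht
  have h2 := (hasDerivAt_pairing_twist hP hg hgc (𝓕 (u t)) t).hasDerivWithinAt (s := Icc 0 T)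
  -- The solution is differentiable only when tested against a fixed function, so the product rule
  -- is done by hand. The cross term is `O(τ - t)` times `o(1)`, by `L²` continuity of `u`.
  have h3 : HasDerivWithinAt (fun τ ↦ pairing (Φ τ - Φ t) (𝓕 (u τ) - 𝓕 (u t))) 0 (Icc 0 T) t := by
    obtain ⟨C, hC⟩ := exists_norm_twist_sub_le hP hg hgc
    rw [hasDerivWithinAt_iff_isLittleO]
    have e1 : (fun τ ↦ Φ τ - Φ t) =O[𝓝[Icc 0 T] t] fun τ ↦ τ - t :=
      Asymptotics.IsBigO.of_bound C (Eventually.of_forall fun τ ↦ hC τ t)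
    have e2 : (fun τ ↦ 𝓕 (u τ) - 𝓕 (u t)) =o[𝓝[Icc 0 T] t] fun _ ↦ (1 : ℝ) := by
      rw [Asymptotics.isLittleO_one_iff, ← sub_self (𝓕 (u t))]
      refine Tendsto.sub_const ?_ _
      exact ((FourierTransform.continuous_fourier (E := L2) (F := L2)).tendsto _).comp (hu t ht)
    have e3 : (fun τ ↦ pairing (Φ τ - Φ t) (𝓕 (u τ) - 𝓕 (u t)))
        =O[𝓝[Icc 0 T] t] fun τ ↦ ‖Φ τ - Φ t‖ * ‖𝓕 (u τ) - 𝓕 (u t)‖ := by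
      refine Asymptotics.IsBigO.of_bound ‖pairing‖ (Eventually.of_forall fun τ ↦ ?_)
      rw [norm_mul, norm_norm, norm_norm, ← mul_assoc]
      exact pairing.le_opNorm₂ _ _
    simpa using e3.trans_isLittleO (e1.norm_left.mul_isLittleO e2.norm_left)
  have h4 := ((h1.add h2).add h3).sub_const (pairing (Φ t) (𝓕 (u t)))
  refine (h4.congr_deriv ?_).congr_of_mem (fun τ _ ↦ ?_) ht
  · have i1 : Integrable fun ζ ↦ twist hP hg hgc t ζ * (-Complex.I * P ζ * (𝓕 (u t) : L2) ζ) := by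
      have hk : MemLp (fun ζ ↦ twist hP hg hgc t ζ * (-Complex.I * P ζ)) 2 volume := by
        refine Continuous.memLp_of_hasCompactSupport ?_ (hgc.mul_left.mul_right)
        have := hP.continuous
        fun_prop
      simpa only [Pi.mul_def, mul_assoc] using hk.integrable_mul (Lp.memLp (𝓕 (u t)))
    have i2 : Integrable fun ζ ↦
        twist hP hg hgc t ζ * (Real.pi * Complex.I * ζ 0 * squareHat (u t) ζ) :=
      Continuous.integrable_of_hasCompactSupport (by fun_prop) hgc.mul_left.mul_right
    rw [spatialPart_apply_fourier, add_zero]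
    simp only [mul_neg, integral_neg]
    rw [neg_add_eq_iff_eq_add, ← sub_eq_add_neg, eq_sub_iff_add_eq, ← integral_add i1 i2]
    refine integral_congr_ae (Eventually.of_forall fun ζ ↦ ?_)
    by_cases hgζ : g ζ = 0
    · simp [twist_apply, hgζ]
    · simp only [hPg ζ hgζ]; ring
  · simp only [Pi.add_apply, Φ, map_sub, _root_.sub_apply]; ring

theorem continuous_twist {P : Plane → ℝ} {g : Plane → ℂ} (hP : ContDiff ℝ (⊤ : ℕ∞) P)
    (hg : ContDiff ℝ (⊤ : ℕ∞) g) (hgc : HasCompactSupport g) :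
    Continuous fun p : ℝ × Plane ↦ twist hP hg hgc p.1 p.2 := by
  have := hP.continuous
  have := hg.continuous
  simp only [twist_apply]
  fun_prop

/-- Duhamel's formula on an open set on which the dispersion relation is a smooth function. -/
theorem duhamel_of_smooth {σ T : ℝ} {u : ℝ → L2} (hsol : IsSolution σ T u)
    (hu : ContinuousOn u (Icc 0 T)) {q : ℝ → Plane →ᵇ ℂ} (hq : Continuous q)
    (hqu : ∀ τ ∈ Icc 0 T, q τ = squareHat (u τ)) {P : Plane → ℝ} (hP : ContDiff ℝ (⊤ : ℕ∞) P)
    {U : Set Plane} (hU : IsOpen U) (hPU : ∀ ζ ∈ U, dispersion σ (ζ 0) (ζ 1) = P ζ)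
    {t₁ t₂ : ℝ} (ht₁ : 0 ≤ t₁) (h₁₂ : t₁ ≤ t₂) (ht₂ : t₂ ≤ T) :
    ∀ᵐ ζ, ζ ∈ U → Complex.exp (-Complex.I * (t₂ * P ζ : ℝ)) * (𝓕 (u t₂) : L2) ζ
      - Complex.exp (-Complex.I * (t₁ * P ζ : ℝ)) * (𝓕 (u t₁) : L2) ζ
      + Real.pi * Complex.I * ζ 0
        * ∫ τ in t₁..t₂, Complex.exp (-Complex.I * (τ * P ζ : ℝ)) * q τ ζ = 0 := by
  have hPc := hP.continuous
  have hqc : Continuous fun p : ℝ × Plane ↦ q p.1 p.2 := by fun_prop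
  set N : Plane → ℂ := fun ζ ↦ Real.pi * Complex.I * ζ 0
        * ∫ τ in t₁..t₂, Complex.exp (-Complex.I * (τ * P ζ : ℝ)) * q τ ζ
  have hNc : Continuous N := by
    refine Continuous.mul (by fun_prop) ?_
    refine intervalIntegral.continuous_parametric_intervalIntegral_of_continuous'
      (f := fun ζ τ ↦ Complex.exp (-Complex.I * (τ * P ζ : ℝ)) * q τ ζ) ?_ _ _
    have : Continuous fun p : Plane × ℝ ↦ q p.2 p.1 := hqc.comp continuous_swap
    unfold Function.uncurry
    fun_prop
  have hloc : ∀ t, LocallyIntegrable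
      (fun ζ ↦ Complex.exp (-Complex.I * (t * P ζ : ℝ)) * (𝓕 (u t) : L2) ζ) := fun t ↦ by
    simpa [mul_comm] using (locallyIntegrable_L2 (𝓕 (u t))).mul_continuous
      (g := fun ζ ↦ Complex.exp (-Complex.I * (t * P ζ : ℝ))) (by fun_prop)
  set A : ℝ → Plane → ℂ := fun t ζ ↦
    Complex.exp (-Complex.I * (t * P ζ : ℝ)) * (𝓕 (u t) : L2) ζ
  have hF : LocallyIntegrable (A t₂ - A t₁ + N) volume :=
    ((hloc t₂).sub (hloc t₁)).add hNc.locallyIntegrable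
  suffices h : ∀ g₀ : Plane → ℝ, ContDiff ℝ (⊤ : ℕ∞) g₀ → HasCompactSupport g₀ →
      tsupport g₀ ⊆ U → ∫ ζ, g₀ ζ • (A t₂ - A t₁ + N) ζ = 0 from
    hU.ae_eq_zero_of_integral_contDiff_smul_eq_zero (hF.locallyIntegrableOn U) h
  intro g₀ hg₀ hgc₀ hgU
  set g : Plane → ℂ := fun ζ ↦ (g₀ ζ : ℂ)
  have hgc : HasCompactSupport g := hgc₀.comp_left (g := ((↑) : ℝ → ℂ)) rfl
  have hg : ContDiff ℝ (⊤ : ℕ∞) g := Complex.ofRealCLM.contDiff.comp hg₀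
  have hPg : ∀ ζ, g ζ ≠ 0 → dispersion σ (ζ 0) (ζ 1) = P ζ := fun ζ hζ ↦
    hPU ζ (hgU (subset_tsupport _ (by simpa [g] using hζ)))
  set Φ := twist hP hg hgc
  set K : ℝ → Plane → ℂ := fun τ ζ ↦ Φ τ ζ * (-(Real.pi * Complex.I * ζ 0 * q τ ζ))
  have hKc : Continuous (Function.uncurry K) := by
    have := continuous_twist hP hg hgc
    unfold Function.uncurry
    fun_prop
  have hK0 : ∀ τ ζ, ζ ∉ tsupport g → K τ ζ = 0 := fun τ ζ hζ ↦ by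
    simp [K, Φ, twist_apply, image_eq_zero_of_notMem_tsupport hζ]
  have hIcc : Icc t₁ t₂ ⊆ Icc 0 T := Icc_subset_Icc ht₁ ht₂
  obtain ⟨B, hB⟩ : ∃ B : ℝ → ℂ, ∀ τ, B τ = pairing ((Φ τ).toLp 2) (𝓕 (u τ)) := ⟨_, fun _ ↦ rfl⟩
  have hderiv : ∀ t ∈ Icc t₁ t₂, HasDerivWithinAt B (∫ ζ, K t ζ) (Icc 0 T) t := fun t ht ↦ by
    rw [funext hB]
    have := hasDerivWithinAt_pairing_twist hsol hu hP hg hgc hPg (hIcc ht)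
    rwa [← hqu t (hIcc ht)] at this
  have hKint : Continuous fun τ ↦ ∫ ζ, K τ ζ := by
    have := continuous_parametric_integral_of_continuous (μ := volume) hKc hgc
    refine this.congr fun τ ↦ setIntegral_eq_integral_of_forall_compl_eq_zero (hK0 τ)
  have hFTC := intervalIntegral.integral_eq_sub_of_hasDerivAt_of_le h₁₂
    (f := B) (fun t ht ↦ ((hderiv t ht).mono hIcc).continuousWithinAt)
    (fun t ht ↦ (hderiv t (Ioo_subset_Icc_self ht)).hasDerivAt
      (mem_of_superset (Icc_mem_nhds ht.1 ht.2) hIcc)) (hKint.intervalIntegrable _ _)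
  have hswap : ∫ τ in t₁..t₂, ∫ ζ, K τ ζ = ∫ ζ, ∫ τ in t₁..t₂, K τ ζ := by
    refine intervalIntegral_integral_swap ?_
    -- For Fubini: the phase has modulus one and `q` is bounded on the compact time interval, so `M`
    -- times a compactly supported function of `ζ` dominates.
    obtain ⟨M, hM⟩ := isCompact_uIcc.exists_bound_of_continuousOn (s := uIcc t₁ t₂) hq.continuousOn
    have hb : Integrable fun ζ : Plane ↦ ‖g ζ * (Real.pi * Complex.I * ζ 0)‖ := by
      have := hg.continuous
      exact (Continuous.integrable_of_hasCompactSupport (by fun_prop) hgc.mul_right).norm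
    have : IsFiniteMeasure (volume.restrict (uIoc t₁ t₂)) :=
      ⟨by simp [uIoc]⟩
    refine ((integrable_const M).mul_prod hb).mono' hKc.aestronglyMeasurable ?_
    filter_upwards [Measure.quasiMeasurePreserving_fst.ae
      (ae_restrict_mem (μ := volume) (measurableSet_uIoc (a := t₁) (b := t₂)))] with p hp
    have h1 := ((q p.1).norm_coe_le_norm p.2).trans (hM p.1 (uIoc_subset_uIcc hp))
    simp only [Function.uncurry, K, Φ, twist_apply, norm_mul, norm_neg, norm_exp_neg_I_mul, one_mul]
    calc _ = ‖q p.1 p.2‖ * (‖g p.2‖ * (‖(Real.pi : ℂ)‖ * ‖Complex.I‖ * ‖((p.2 0 : ℝ) : ℂ)‖)) := by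
          ring
      _ ≤ _ := mul_le_mul_of_nonneg_right h1 (by positivity)
  have hN : ∀ ζ, ∫ τ in t₁..t₂, K τ ζ = -(g ζ * N ζ) := fun ζ ↦ by
    simp only [N, ← intervalIntegral.integral_const_mul, ← intervalIntegral.integral_neg]
    refine intervalIntegral.integral_congr fun τ _ ↦ ?_
    simp only [K, Φ, twist_apply]
    ring
  have i1 := ((hloc t₂).integrable_smul_left_of_hasCompactSupport hg₀.continuous hgc₀)
  have i2 := ((hloc t₁).integrable_smul_left_of_hasCompactSupport hg₀.continuous hgc₀)
  have i3 := (hNc.locallyIntegrable (μ := volume)).integrable_smul_left_of_hasCompactSupport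
    hg₀.continuous hgc₀
  simp only [smul_add, smul_sub, Pi.add_apply, Pi.sub_apply]
  rw [integral_add (f := fun ζ ↦ g₀ ζ • A t₂ ζ - g₀ ζ • A t₁ ζ) (i1.sub i2) i3,
    integral_sub (f := fun ζ ↦ g₀ ζ • A t₂ ζ) i1 i2]
  rw [hswap] at hFTC
  simp only [hN, integral_neg, hB, pairing_toLp] at hFTC
  have e : ∀ t, ∫ ζ, g₀ ζ • A t ζ
      = ∫ ζ, Φ t ζ * (𝓕 (u t) : L2) ζ := fun t ↦ by
    refine integral_congr_ae (Eventually.of_forall fun ζ ↦ ?_)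
    simp only [A, Φ, twist_apply, Complex.real_smul, g]
    ring
  rw [e, e, ← hFTC]
  simp [g]

/-- Duhamel's formula on the Fourier side. -/
theorem duhamel {σ T : ℝ} {u : ℝ → L2} (hsol : IsSolution σ T u)
    (hu : ContinuousOn u (Icc 0 T)) {q : ℝ → Plane →ᵇ ℂ} (hq : Continuous q)
    (hqu : ∀ τ ∈ Icc 0 T, q τ = squareHat (u τ))
    {t₁ t₂ : ℝ} (ht₁ : 0 ≤ t₁) (h₁₂ : t₁ ≤ t₂) (ht₂ : t₂ ≤ T) :
    ∀ᵐ ζ : Plane, (𝓕 (u t₂) : L2) ζ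
      = Complex.exp (Complex.I * ((t₂ - t₁) * dispersion σ (ζ 0) (ζ 1) : ℝ)) * (𝓕 (u t₁) : L2) ζ
      - Real.pi * Complex.I * ζ 0 * ∫ τ in t₁..t₂,
        Complex.exp (Complex.I * ((t₂ - τ) * dispersion σ (ζ 0) (ζ 1) : ℝ)) * q τ ζ := by
  -- The dispersion relation is `P` for `ξ > 0` and `-P` for `ξ < 0`, smooth on each open
  -- half-plane. The line `ξ = 0` is null.
  set P : Plane → ℝ := fun ζ ↦ 1 + 4 * Real.pi ^ 2 * ζ 0 ^ 2 - 4 * Real.pi ^ 2 * σ * ζ 1 ^ 2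
  have hP : ContDiff ℝ (⊤ : ℕ∞) P := by fun_prop
  have hpos := duhamel_of_smooth hsol hu hq hqu hP (U := {ζ | 0 < ζ 0})
    (isOpen_lt continuous_const (by fun_prop))
    (fun ζ hζ ↦ by
      have : SignType.sign (ζ 0) = 1 := sign_pos hζ
      simp [dispersion, P, this]) ht₁ h₁₂ ht₂
  have hneg := duhamel_of_smooth hsol hu hq hqu hP.neg (U := {ζ | ζ 0 < 0})
    (isOpen_lt (by fun_prop) continuous_const)
    (fun ζ hζ ↦ by
      have : SignType.sign (ζ 0) = -1 := sign_neg hζ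
      simp [dispersion, P, this]) ht₁ h₁₂ ht₂
  have h0 : ∀ᵐ ζ : Plane, ζ 0 ≠ 0 := ae_plane_of_ae_zero (Measure.ae_ne volume 0)
  have conclude : ∀ (p : ℝ) (ζ : Plane),
      Complex.exp (-Complex.I * (t₂ * p : ℝ)) * (𝓕 (u t₂) : L2) ζ
        - Complex.exp (-Complex.I * (t₁ * p : ℝ)) * (𝓕 (u t₁) : L2) ζ
        + Real.pi * Complex.I * ζ 0
          * ∫ τ in t₁..t₂, Complex.exp (-Complex.I * (τ * p : ℝ)) * q τ ζ = 0 →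
      (𝓕 (u t₂) : L2) ζ
        = Complex.exp (Complex.I * ((t₂ - t₁) * p : ℝ)) * (𝓕 (u t₁) : L2) ζ
        - Real.pi * Complex.I * ζ 0 * ∫ τ in t₁..t₂,
          Complex.exp (Complex.I * ((t₂ - τ) * p : ℝ)) * q τ ζ := by
    intro p ζ h
    have e : ∀ τ : ℝ, Complex.exp (Complex.I * ((t₂ - τ) * p : ℝ))
        = Complex.exp (Complex.I * (t₂ * p : ℝ)) * Complex.exp (-Complex.I * (τ * p : ℝ)) := by
      intro τ
      rw [← Complex.exp_add]
      congr 1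
      push_cast; ring
    have e1 : Complex.exp (Complex.I * (t₂ * p : ℝ)) * Complex.exp (-Complex.I * (t₂ * p : ℝ))
        = 1 := by
      rw [← e]; simp
    simp only [e, mul_assoc, intervalIntegral.integral_const_mul]
    simp only [mul_assoc] at h
    linear_combination (Complex.exp (Complex.I * (t₂ * p : ℝ))) * h - (𝓕 (u t₂) : L2) ζ * e1
  filter_upwards [hpos, hneg, h0] with ζ h1 h2 h3
  rcases lt_or_gt_of_ne h3 with h | h
  · have hd : dispersion σ (ζ 0) (ζ 1) = -P ζ := by
      have : SignType.sign (ζ 0) = -1 := sign_neg h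
      simp [dispersion, P, this]
    rw [hd]
    exact conclude _ ζ (h2 h)
  · have hd : dispersion σ (ζ 0) (ζ 1) = P ζ := by
      have : SignType.sign (ζ 0) = 1 := sign_pos h
      simp [dispersion, P, this]
    rw [hd]
    exact conclude _ ζ (h1 h)

/-! ### Jumps of the Fourier transform -/

theorem lintegral_enorm_sq_eq_eLpNorm_sq (f : Plane → ℂ) :
    ∫⁻ z, ‖f z‖ₑ ^ 2 = eLpNorm f 2 volume ^ 2 := by
  have := eLpNorm_nnreal_pow_eq_lintegral (f := f) (μ := volume) (p := 2) two_ne_zero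
  simpa using this.symm

theorem lintegral_enorm_fourier_sq (f : L2) :
    ∫⁻ ζ, ‖(𝓕 f : L2) ζ‖ₑ ^ 2 = ∫⁻ z, ‖f z‖ₑ ^ 2 := by
  rw [lintegral_enorm_sq_eq_eLpNorm_sq, lintegral_enorm_sq_eq_eLpNorm_sq, ← Lp.enorm_def,
    ← Lp.enorm_def, ← ofReal_norm, ← ofReal_norm, Lp.norm_fourier_eq]

theorem memLp_modulation (f : L2) (v : Plane) :
    MemLp (fun z ↦ Complex.exp (2 * Real.pi * Complex.I * (inner ℝ z v : ℝ)) * f z) 2 volume := by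
  refine (Lp.memLp f).of_le (Continuous.aestronglyMeasurable (by fun_prop) |>.mul
    (Lp.aestronglyMeasurable f)) (Eventually.of_forall fun z ↦ ?_)
  simp [Complex.norm_exp]

/-- Plancherel, applied to a modulation of `f` minus `f`. -/
theorem lintegral_enorm_fourier_sub_translate (f : L2) (v : Plane) :
    ∫⁻ ζ, ‖(𝓕 f : L2) (ζ + v) - (𝓕 f : L2) ζ‖ₑ ^ 2
      = ∫⁻ z, ‖Complex.exp (2 * Real.pi * Complex.I * (inner ℝ z (-v) : ℝ)) - 1‖ₑ ^ 2
        * ‖f z‖ₑ ^ 2 := by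
  have hk := (memLp_modulation f (-v)).coeFn_toLp
  set k : L2 := (memLp_modulation f (-v)).toLp
  have h1 : ∀ᵐ ζ, (𝓕 (k - f) : L2) ζ = (𝓕 f : L2) (ζ + v) - (𝓕 f : L2) ζ := by
    have e : (𝓕 (k - f) : L2) = 𝓕 k - 𝓕 f := (Lp.fourierTransformₗᵢ Plane ℂ).map_sub k f
    rw [e]
    filter_upwards [Lp.coeFn_sub (𝓕 k : L2) (𝓕 f : L2), fourier_modulation f k (-v) hk]
      with ζ h2 h3
    rw [h2, Pi.sub_apply, h3, sub_neg_eq_add]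
  have h2 : ∫⁻ ζ, ‖(𝓕 f : L2) (ζ + v) - (𝓕 f : L2) ζ‖ₑ ^ 2 = ∫⁻ ζ, ‖(𝓕 (k - f) : L2) ζ‖ₑ ^ 2 :=
    lintegral_congr_ae (h1.mono fun ζ h ↦ by simp only [h])
  rw [h2, lintegral_enorm_fourier_sq]
  refine lintegral_congr_ae ?_
  filter_upwards [hk, Lp.coeFn_sub k f] with z h2 h3
  rw [h3, Pi.sub_apply, h2, ← mul_pow, ← enorm_mul, sub_mul, one_mul]

theorem norm_exp_two_pi_I_sub_one_le (x : ℝ) :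
    ‖Complex.exp (2 * Real.pi * Complex.I * x) - 1‖ ≤ 2 * Real.pi * |x| := by
  have h := Real.norm_exp_I_mul_ofReal_sub_one_le (x := 2 * Real.pi * x)
  have e : 2 * Real.pi * Complex.I * x = Complex.I * ((2 * Real.pi * x : ℝ) : ℂ) := by
    push_cast; ring
  rw [e]
  refine h.trans_eq ?_
  rw [Real.norm_eq_abs, abs_mul, abs_of_pos Real.two_pi_pos]

/-- The product of the bounds `2` and `2π|x|`. Being linear in `|x|`, it yields a dominating
function with the weight `|x|`. -/
theorem norm_exp_two_pi_I_sub_one_sq_le (x : ℝ) :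
    ‖Complex.exp (2 * Real.pi * Complex.I * x) - 1‖ ^ 2 ≤ 4 * Real.pi * |x| := by
  have h1 := norm_exp_two_pi_I_sub_one_le x
  have h2 : ‖Complex.exp (2 * Real.pi * Complex.I * x) - 1‖ ≤ 2 := by
    refine (norm_sub_le _ _).trans ?_
    have : ‖Complex.exp (2 * Real.pi * Complex.I * x)‖ = 1 := by simp [Complex.norm_exp]
    rw [this, norm_one]; norm_num
  nlinarith [norm_nonneg (Complex.exp (2 * Real.pi * Complex.I * x) - 1)]

/-- With `h = 1/(n+1)`, the multiplier `h⁻¹ |exp (-2πihx) - 1|²` is at most `4π|x|` and is `O(h)`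
for fixed `x`, so dominated convergence applies. -/
theorem tendsto_lintegral_enorm_sub_translate {f : L2}
    (hf : ∫⁻ z : Plane, ‖z 0‖ₑ * ‖f z‖ₑ ^ 2 ≠ ∞) :
    Tendsto (fun n : ℕ ↦ ((n : ℝ≥0∞) + 1) * ∫⁻ ζ,
      ‖(𝓕 f : L2) (ζ + (1 / (n + 1) : ℝ) • ex) - (𝓕 f : L2) ζ‖ₑ ^ 2) atTop (𝓝 0) := by
  simp only [lintegral_enorm_fourier_sub_translate]
  have hm : ∀ n : ℕ, Measurable fun z : Plane ↦
      ‖Complex.exp (2 * Real.pi * Complex.I * (inner ℝ z (-((1 / (n + 1) : ℝ) • ex)) : ℝ))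
        - 1‖ₑ ^ 2 := fun n ↦ by fun_prop
  have hfm : AEMeasurable (fun z ↦ ‖f z‖ₑ ^ 2) volume :=
    (Lp.aestronglyMeasurable f).enorm.pow_const 2
  have key : ∀ (n : ℕ) (z : Plane) (c : ℝ), 0 ≤ c →
      (n + 1) * ‖Complex.exp (2 * Real.pi * Complex.I
        * (inner ℝ z (-((1 / (n + 1) : ℝ) • ex)) : ℝ)) - 1‖ ^ 2 ≤ c →
      ((n : ℝ≥0∞) + 1) * (‖Complex.exp (2 * Real.pi * Complex.I
        * (inner ℝ z (-((1 / (n + 1) : ℝ) • ex)) : ℝ)) - 1‖ₑ ^ 2 * ‖f z‖ₑ ^ 2)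
        ≤ ENNReal.ofReal c * ‖f z‖ₑ ^ 2 := by
    intro n z c hc h
    rw [← mul_assoc]
    gcongr
    refine le_trans (le_of_eq ?_) (ENNReal.ofReal_le_ofReal h)
    rw [ENNReal.ofReal_mul (by positivity), ENNReal.ofReal_pow (norm_nonneg _), ofReal_norm,
      ENNReal.ofReal_add (by positivity) zero_le_one]
    simp
  have hinner : ∀ (n : ℕ) (z : Plane),
      |(inner ℝ z (-((1 / (n + 1) : ℝ) • ex)) : ℝ)| = |z 0| / (n + 1) := by
    intro n z
    rw [inner_neg_right, inner_smul_right, inner_ex, abs_neg, abs_mul,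
      abs_of_pos (by positivity : (0 : ℝ) < 1 / (n + 1))]
    ring
  have hn : ∀ n : ℕ, (n : ℝ≥0∞) + 1 ≠ ∞ := fun n ↦ by simp
  simp_rw [← lintegral_const_mul' _ _ (hn _)]
  rw [← lintegral_zero (α := Plane) (μ := volume)]
  refine tendsto_lintegral_of_dominated_convergence'
    (fun z ↦ ENNReal.ofReal (4 * Real.pi * |z 0|) * ‖f z‖ₑ ^ 2)
    (fun n ↦ ((hm n).aemeasurable.mul hfm).const_mul _)
    (fun n ↦ Eventually.of_forall fun z ↦ key n z _ (by positivity) ?_) ?_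
    (Eventually.of_forall fun z ↦ ?_)
  · have h := norm_exp_two_pi_I_sub_one_sq_le (inner ℝ z (-((1 / (n + 1) : ℝ) • ex)))
    rw [hinner] at h
    calc _ ≤ ((n : ℝ) + 1) * (4 * Real.pi * (|z 0| / (n + 1))) := by gcongr
      _ = _ := by field_simp
  · have e : ∀ z : Plane, ENNReal.ofReal (4 * Real.pi * |z 0|) * ‖f z‖ₑ ^ 2
        = ENNReal.ofReal (4 * Real.pi) * (‖z 0‖ₑ * ‖f z‖ₑ ^ 2) := fun z ↦ by
      rw [ENNReal.ofReal_mul (by positivity), mul_assoc, ← Real.norm_eq_abs, ofReal_norm]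
    simp only [e]
    rw [lintegral_const_mul' _ _ ENNReal.ofReal_ne_top]
    exact ENNReal.mul_ne_top ENNReal.ofReal_ne_top hf
  · have hlim : Tendsto (fun n : ℕ ↦
        ENNReal.ofReal ((2 * Real.pi * |z 0|) ^ 2 * (1 / ((n : ℝ) + 1))) * ‖f z‖ₑ ^ 2)
        atTop (𝓝 0) := by
      have h1 := tendsto_one_div_add_atTop_nhds_zero_nat (𝕜 := ℝ)
      have h2 := ENNReal.tendsto_ofReal (h1.const_mul ((2 * Real.pi * |z 0|) ^ 2))
      have h3 := ENNReal.Tendsto.mul_const h2 (b := ‖f z‖ₑ ^ 2)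
        (Or.inr (ENNReal.pow_ne_top enorm_ne_top))
      simpa using h3
    refine tendsto_of_tendsto_of_tendsto_of_le_of_le tendsto_const_nhds hlim
      (fun n ↦ zero_le) (fun n ↦ key n z _ (by positivity) ?_)
    have h := norm_exp_two_pi_I_sub_one_le (inner ℝ z (-((1 / (n + 1) : ℝ) • ex)))
    rw [hinner] at h
    calc _ ≤ ((n : ℝ) + 1) * (2 * Real.pi * (|z 0| / (n + 1))) ^ 2 := by gcongr
      _ = _ := by field_simp

theorem measurable_translate_difference {F : Plane → ℂ} (hF : Measurable F) (h : ℝ) :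
    Measurable fun q : ℝ × ℝ ↦ ‖F (xy.symm (q.2 + h, q.1)) - F (xy.symm (q.2, q.1))‖ₑ ^ 2 := by
  have h1 : Measurable fun q : ℝ × ℝ ↦ xy.symm (q.2 + h, q.1) :=
    xy.symm.measurable.comp (by fun_prop)
  have h2 : Measurable fun q : ℝ × ℝ ↦ xy.symm (q.2, q.1) :=
    xy.symm.measurable.comp (by fun_prop)
  exact ((hF.comp h1).sub (hF.comp h2)).enorm.pow_const 2

/-- A function with distinct one-sided limits at `0` has large mean oscillation there. -/
theorem exists_eventually_le_lintegral_of_jump {G : ℝ → ℂ} {a b : ℂ} (hab : a ≠ b)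
    (ha : Tendsto G (𝓝[>] 0) (𝓝 a)) (hb : Tendsto G (𝓝[<] 0) (𝓝 b)) :
    ∃ c : ℝ≥0∞, 0 < c ∧ ∀ᶠ n : ℕ in atTop, c ≤ ((n : ℝ≥0∞) + 1) *
      ∫⁻ ξ in Ioo (-(1 / (n + 1)) : ℝ) 0, ‖G (ξ + 1 / (n + 1)) - G ξ‖ₑ ^ 2 := by
  -- With a third of the jump, two errors below `r` still leave a difference of at least `r`.
  set r := ‖a - b‖ / 3
  have hr : 0 < r := by have := norm_pos_iff.2 (sub_ne_zero.2 hab); positivity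
  obtain ⟨δ₁, hδ₁, h₁⟩ := Metric.tendsto_nhdsWithin_nhds.1 ha r hr
  obtain ⟨δ₂, hδ₂, h₂⟩ := Metric.tendsto_nhdsWithin_nhds.1 hb r hr
  refine ⟨ENNReal.ofReal r ^ 2, by positivity, ?_⟩
  have hlim := tendsto_one_div_add_atTop_nhds_zero_nat (𝕜 := ℝ)
  filter_upwards [hlim.eventually_lt_const hδ₁, hlim.eventually_lt_const hδ₂] with n hn₁ hn₂
  have hpos : (0 : ℝ) < 1 / (n + 1) := by positivity
  -- For these `ξ`, the points `ξ` and `ξ + 1/(n+1)` lie on opposite sides of `0`.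
  have hle : ∀ ξ ∈ Ioo (-(1 / (n + 1)) : ℝ) 0,
      ENNReal.ofReal r ^ 2 ≤ ‖G (ξ + 1 / (n + 1)) - G ξ‖ₑ ^ 2 := by
    intro ξ hξ
    have d1 : dist (G (ξ + 1 / (n + 1))) a < r := by
      refine h₁ (show 0 < ξ + 1 / ((n : ℝ) + 1) by linarith [hξ.1]) ?_
      rw [Real.dist_eq, sub_zero, abs_of_pos (by linarith [hξ.1])]
      linarith [hξ.2]
    have d2 : dist (G ξ) b < r := by
      refine h₂ hξ.2 ?_
      rw [Real.dist_eq, sub_zero, abs_of_neg hξ.2]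
      linarith [hξ.1]
    have d3 : dist a b = 3 * r := by rw [dist_eq_norm]; simp only [r]; ring
    have d4 : r ≤ ‖G (ξ + 1 / (n + 1)) - G ξ‖ := by
      rw [← dist_eq_norm]
      have t1 := dist_triangle4 a (G (ξ + 1 / (n + 1))) (G ξ) b
      rw [dist_comm a (G _)] at t1
      linarith
    rw [← ofReal_norm]
    gcongr
  have hn : ((n : ℝ≥0∞) + 1) * ENNReal.ofReal (1 / (n + 1)) = 1 := by
    have e : (n : ℝ≥0∞) + 1 = ENNReal.ofReal ((n : ℝ) + 1) := by
      rw [ENNReal.ofReal_add (by positivity) zero_le_one]; simp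
    rw [e, ← ENNReal.ofReal_mul (by positivity), mul_one_div_cancel (by positivity),
      ENNReal.ofReal_one]
  calc ENNReal.ofReal r ^ 2
      = ((n : ℝ≥0∞) + 1) * ∫⁻ _ in Ioo (-(1 / (n + 1)) : ℝ) 0, ENNReal.ofReal r ^ 2 := by
        rw [setLIntegral_const, Real.volume_Ioo, zero_sub, neg_neg, mul_left_comm, hn, mul_one]
    _ ≤ _ := by
        exact mul_le_mul' le_rfl (setLIntegral_mono' measurableSet_Ioo hle)

/-- If `|x|^{1/2} f` is square integrable, then `𝓕 f` cannot jump across `ξ = 0`. -/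
theorem ae_eq_of_tendsto_fourier {f : L2} (hf : ∫⁻ z : Plane, ‖z 0‖ₑ * ‖f z‖ₑ ^ 2 ≠ ∞)
    {G : ℝ → ℝ → ℂ} (hG : ∀ᵐ ζ : Plane, (𝓕 f : L2) ζ = G (ζ 0) (ζ 1)) {a b : ℝ → ℂ}
    (ha : ∀ᵐ η, Tendsto (fun ξ ↦ G ξ η) (𝓝[>] 0) (𝓝 (a η)))
    (hb : ∀ᵐ η, Tendsto (fun ξ ↦ G ξ η) (𝓝[<] 0) (𝓝 (b η))) : a =ᵐ[volume] b := by
  obtain ⟨F, hFm, hF⟩ : ∃ F : Plane → ℂ, Measurable F ∧ (𝓕 f : L2) =ᵐ[volume] F :=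
    ⟨_, (Lp.stronglyMeasurable (𝓕 f : L2)).measurable, ae_eq_refl _⟩
  set Φ : ℕ → ℝ → ℝ≥0∞ := fun n η ↦ ((n : ℝ≥0∞) + 1) *
    ∫⁻ ξ in Ioo (-(1 / (n + 1)) : ℝ) 0,
      ‖F (xy.symm (ξ + 1 / (n + 1), η)) - F (xy.symm (ξ, η))‖ₑ ^ 2
  have hΦm : ∀ n, Measurable (Φ n) := fun n ↦
    (Measurable.lintegral_prod_right' (measurable_translate_difference hFm _)).const_mul _
  have hΦ : Tendsto (fun n ↦ ∫⁻ η, Φ n η) atTop (𝓝 0) := by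
    refine tendsto_of_tendsto_of_tendsto_of_le_of_le tendsto_const_nhds
      (tendsto_lintegral_enorm_sub_translate hf) (fun n ↦ zero_le) fun n ↦ ?_
    have hmeas : Measurable fun ζ ↦ ‖F (ζ + (1 / (n + 1) : ℝ) • ex) - F ζ‖ₑ ^ 2 :=
      ((hFm.comp (measurable_add_const _)).sub hFm).enorm.pow_const 2
    have hshift : ∀ᵐ ζ, (𝓕 f : L2) (ζ + (1 / (n + 1) : ℝ) • ex) = F (ζ + (1 / (n + 1) : ℝ) • ex) :=
      (measurePreserving_add_right _ _).quasiMeasurePreserving.ae hF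
    have e : ∫⁻ ζ, ‖(𝓕 f : L2) (ζ + (1 / (n + 1) : ℝ) • ex) - (𝓕 f : L2) ζ‖ₑ ^ 2
        = ∫⁻ ζ, ‖F (ζ + (1 / (n + 1) : ℝ) • ex) - F ζ‖ₑ ^ 2 := by
      refine lintegral_congr_ae ?_
      filter_upwards [hF, hshift] with ζ h1 h2
      rw [h1, h2]
    rw [e, lintegral_plane hmeas, lintegral_const_mul' _ _ (by simp)]
    simp only [xy_symm_add_smul_ex]
    gcongr
    exact Measure.restrict_le_self
  -- Fatou turns convergence of the integrals to `0` into a statement on almost every line, where it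
  -- meets the lower bound caused by a jump.
  have hfatou : ∫⁻ η, liminf (fun n ↦ Φ n η) atTop = 0 := by
    refine le_antisymm ((lintegral_liminf_le hΦm).trans_eq hΦ.liminf_eq) zero_le
  rw [lintegral_eq_zero_iff (Measurable.liminf hΦm)] at hfatou
  have hFG : ∀ᵐ η : ℝ, ∀ᵐ ξ : ℝ, F (xy.symm (ξ, η)) = G ξ η := by
    have h1 : ∀ᵐ ζ, F ζ = G (ζ 0) (ζ 1) := by
      filter_upwards [hF, hG] with ζ h1 h2
      rw [← h1, h2]
    filter_upwards [ae_ae_of_ae_plane h1] with η hη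
    filter_upwards [hη] with ξ hξ
    rw [hξ, xy_symm_zero, xy_symm_one]
  filter_upwards [hfatou, hFG, ha, hb] with η h0 h1 h2 h3
  by_contra hne
  obtain ⟨c, hc, hev⟩ := exists_eventually_le_lintegral_of_jump hne h2 h3
  refine hc.not_ge (le_trans ?_ h0.le)
  refine le_liminf_of_le (by isBoundedDefault) ?_
  filter_upwards [hev] with n hn
  refine hn.trans_eq ?_
  simp only [Φ]
  congr 1
  have hsh : ∀ᵐ ξ : ℝ, F (xy.symm (ξ + 1 / (n + 1), η)) = G (ξ + 1 / (n + 1)) η :=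
    (measurePreserving_add_right _ _).quasiMeasurePreserving.ae h1
  refine lintegral_congr_ae (ae_restrict_of_ae ?_)
  filter_upwards [h1, hsh] with ξ e1 e2
  rw [e1, e2]

/-! ### The Fourier transform of the gamma density -/

/-- The unnormalized gamma density `t ^ (a - 1) exp (-t)` on the positive half-line. -/
def gammaKernel (a t : ℝ) : ℝ := Real.exp (-t) * t ^ (a - 1)

theorem integrableOn_gammaKernel {a : ℝ} (ha : 0 < a) : IntegrableOn (gammaKernel a) (Ioi 0) :=
  Real.GammaIntegral_convergent ha

theorem gammaKernel_nonneg (a : ℝ) {t : ℝ} (ht : 0 < t) : 0 ≤ gammaKernel a t := by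
  unfold gammaKernel; positivity

theorem measurable_gammaKernel (a : ℝ) : Measurable (gammaKernel a) := by
  unfold gammaKernel; fun_prop

theorem gammaKernel_add_one (a : ℝ) {t : ℝ} (ht : 0 < t) :
    gammaKernel (a + 1) t = t * gammaKernel a t := by
  rw [gammaKernel, gammaKernel, add_sub_cancel_right, Real.rpow_sub_one ht.ne']
  field_simp

/-- The integral `∫ t ^ (a - 1) exp (-t) exp (-i t y) dt` over the positive half-line. -/
def gammaFourier (a y : ℝ) : ℂ :=
  ∫ t in Ioi 0, (gammaKernel a t : ℂ) * Complex.exp (-(Complex.I * (t * y : ℝ)))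

theorem norm_exp_neg_I_mul_real (x : ℝ) : ‖Complex.exp (-(Complex.I * x))‖ = 1 := by
  simp [Complex.norm_exp]

theorem integrableOn_gammaKernel_mul_exp {a : ℝ} (ha : 0 < a) (y : ℝ) :
    IntegrableOn (fun t : ℝ ↦ (gammaKernel a t : ℂ) * Complex.exp (-(Complex.I * (t * y : ℝ))))
      (Ioi 0) := by
  refine (integrableOn_gammaKernel ha).ofReal.mul_bdd (c := 1)
    (Continuous.aestronglyMeasurable (by fun_prop)) (Eventually.of_forall fun t ↦ ?_)
  rw [norm_exp_neg_I_mul_real]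

theorem hasDerivAt_gammaFourier {a : ℝ} (ha : 0 < a) (y : ℝ) :
    HasDerivAt (gammaFourier a) (-Complex.I * gammaFourier (a + 1) y) y := by
  have h := (hasDerivAt_integral_of_dominated_loc_of_deriv_le (s := univ)
    (μ := volume.restrict (Ioi 0)) (x₀ := y)
    (F := fun y t ↦ (gammaKernel a t : ℂ) * Complex.exp (-(Complex.I * (t * y : ℝ))))
    (F' := fun y t ↦ -Complex.I *
      ((gammaKernel (a + 1) t : ℂ) * Complex.exp (-(Complex.I * (t * y : ℝ)))))
    (bound := gammaKernel (a + 1)) univ_mem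
    (Eventually.of_forall fun y ↦ (integrableOn_gammaKernel_mul_exp ha y).aestronglyMeasurable)
    (integrableOn_gammaKernel_mul_exp ha y)
    ((integrableOn_gammaKernel_mul_exp (by linarith) y).aestronglyMeasurable.const_mul _)
    ?_ (integrableOn_gammaKernel (by linarith)) ?_).2
  · rw [integral_const_mul] at h
    exact h
  · filter_upwards [ae_restrict_mem measurableSet_Ioi] with t ht y _
    rw [norm_mul, norm_mul, norm_exp_neg_I_mul_real, norm_neg, Complex.norm_I, one_mul, mul_one,
      Complex.norm_real, Real.norm_of_nonneg (gammaKernel_nonneg _ ht)]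
  · filter_upwards [ae_restrict_mem measurableSet_Ioi] with t ht y _
    have h1 : HasDerivAt (fun y : ℝ ↦ -(Complex.I * ((t * y : ℝ) : ℂ))) (-(Complex.I * t)) y := by
      have := (((hasDerivAt_id y).const_mul t).ofReal_comp.const_mul (-Complex.I))
      simpa using this
    refine (h1.cexp.const_mul (gammaKernel a t : ℂ)).congr_deriv ?_
    rw [gammaKernel_add_one a ht]
    push_cast
    ring

/-- Integrate the derivative of `t^a exp (-t) exp (-ity)`: both boundary terms vanish because `a >
0`. -/
theorem one_add_mul_gammaFourier {a : ℝ} (ha : 0 < a) (y : ℝ) :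
    (1 + Complex.I * y) * gammaFourier (a + 1) y = a * gammaFourier a y := by
  set W : ℝ → ℂ := fun t ↦ ((Real.exp (-t) * t ^ a : ℝ) : ℂ)
    * Complex.exp (-(Complex.I * (t * y : ℝ)))
  have hint := ((integrableOn_gammaKernel_mul_exp ha y).const_mul (a : ℂ)).sub
    ((integrableOn_gammaKernel_mul_exp (a := a + 1) (by linarith) y).const_mul (1 + Complex.I * y))
  have hcont : Continuous W := by
    have := Real.continuous_rpow_const (q := a) ha.le
    fun_prop
  have hlim : Tendsto W atTop (𝓝 0) := by
    rw [tendsto_zero_iff_norm_tendsto_zero]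
    have h := tendsto_rpow_mul_exp_neg_mul_atTop_nhds_zero a 1 one_pos
    refine h.congr' ?_
    filter_upwards [eventually_ge_atTop 0] with t ht
    rw [norm_mul, norm_exp_neg_I_mul_real, mul_one, Complex.norm_real,
      Real.norm_of_nonneg (by positivity), neg_one_mul, mul_comm]
  have h := integral_Ioi_of_hasDerivAt_of_tendsto hcont.continuousWithinAt (a := 0)
    (fun t ht ↦ ?_) hint hlim
  · simp only [Pi.sub_apply] at h
    rw [integral_sub ((integrableOn_gammaKernel_mul_exp ha y).const_mul (a : ℂ))
      ((integrableOn_gammaKernel_mul_exp (a := a + 1) (by linarith) y).const_mul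
        (1 + Complex.I * y)), integral_const_mul, integral_const_mul] at h
    have hW0 : W 0 = 0 := by simp [W, Real.zero_rpow ha.ne']
    rw [hW0, sub_zero, sub_eq_zero] at h
    exact h.symm
  · have ht' : (0 : ℝ) < t := ht
    have h1 : HasDerivAt (fun t : ℝ ↦ Real.exp (-t) * t ^ a)
        (-Real.exp (-t) * t ^ a + Real.exp (-t) * (a * t ^ (a - 1))) t := by
      have e1 : HasDerivAt (fun t : ℝ ↦ Real.exp (-t)) (-Real.exp (-t)) t := by
        simpa using (hasDerivAt_neg t).exp
      exact e1.mul (Real.hasDerivAt_rpow_const (Or.inl ht'.ne'))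
    have h2 : HasDerivAt (fun t : ℝ ↦ -(Complex.I * ((t * y : ℝ) : ℂ))) (-(Complex.I * y)) t := by
      have := (((hasDerivAt_id t).mul_const y).ofReal_comp.const_mul (-Complex.I))
      simpa using this
    refine (h1.ofReal_comp.mul h2.cexp).congr_deriv ?_
    simp only [Pi.sub_apply, gammaKernel, add_sub_cancel_right]
    push_cast
    ring

/-- The derivative formula and the recursion in `a` form a first-order ODE, by which `gammaFourier a
y * (1 + iy)^a` is constant. Its value at `y = 0` is `Γ(a)`; the power is smooth since `1 + iy` has
real part `1`. -/
theorem norm_gammaFourier_mul {a : ℝ} (ha : 0 < a) (y : ℝ) :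
    ‖gammaFourier a y‖ * ‖(1 + Complex.I * y : ℂ)‖ ^ a = Real.Gamma a := by
  have hslit : ∀ y : ℝ, (1 + Complex.I * y : ℂ) ∈ Complex.slitPlane := fun y ↦ by
    left; simp
  have hne : ∀ y : ℝ, (1 + Complex.I * y : ℂ) ≠ 0 := fun y ↦ Complex.slitPlane_ne_zero (hslit y)
  have hd : ∀ y,
      HasDerivAt (fun y : ℝ ↦ gammaFourier a y * (1 + Complex.I * y : ℂ) ^ (a : ℂ)) 0 y := by
    intro y
    have h1 : HasDerivAt (fun y : ℝ ↦ (1 + Complex.I * y : ℂ)) Complex.I y := by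
      have := ((hasDerivAt_id y).ofReal_comp.const_mul Complex.I).const_add 1
      simpa using this
    have h2 := ((hasDerivAt_id _).cpow_const (c := (a : ℂ)) (hslit y)).comp y h1
    refine ((hasDerivAt_gammaFourier ha y).mul h2).congr_deriv ?_
    simp only [Function.comp_apply, id]
    rw [Complex.cpow_sub _ _ (hne y), Complex.cpow_one]
    have := one_add_mul_gammaFourier ha y
    field_simp [hne y]
    linear_combination (-Complex.I * (1 + Complex.I * y : ℂ) ^ (a : ℂ)) * this
  have hconst := is_const_of_deriv_eq_zero (fun y ↦ (hd y).differentiableAt)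
    (fun y ↦ (hd y).deriv) y 0
  have h0 : gammaFourier a 0 = Real.Gamma a := by
    rw [Real.Gamma_eq_integral ha, ← integral_complex_ofReal]
    simp [gammaFourier, gammaKernel]
  rw [← Complex.norm_cpow_real, ← norm_mul, hconst, h0]
  simp [abs_of_pos (Real.Gamma_pos_of_pos ha)]

/-- Shows that dividing `f` by `gammaFourier` costs no more than the weight `1 + |x|^a`. -/
theorem inv_norm_gammaFourier_le {a : ℝ} (ha : 0 < a) (y : ℝ) :
    ‖gammaFourier a y‖⁻¹ ≤ 2 ^ a / Real.Gamma a * (1 + |y| ^ a) := by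
  have h := norm_gammaFourier_mul ha y
  have hΓ := Real.Gamma_pos_of_pos ha
  have hy : ‖(1 + Complex.I * y : ℂ)‖ ≤ 1 + |y| := (norm_add_le _ _).trans (by simp)
  have h1 : ‖(1 + Complex.I * y : ℂ)‖ ^ a ≤ 2 ^ a * (1 + |y| ^ a) := by
    calc ‖(1 + Complex.I * y : ℂ)‖ ^ a ≤ (2 * max 1 |y|) ^ a := by
          refine Real.rpow_le_rpow (norm_nonneg _) (hy.trans ?_) ha.le
          linarith [le_max_left 1 |y|, le_max_right 1 |y|]
      _ = 2 ^ a * (max 1 |y|) ^ a := Real.mul_rpow zero_le_two (by positivity)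
      _ ≤ 2 ^ a * (1 + |y| ^ a) := by
          gcongr
          rcases le_total 1 |y| with h | h
          · rw [max_eq_right h]; linarith
          · rw [max_eq_left h, Real.one_rpow]; linarith [Real.rpow_nonneg (abs_nonneg y) a]
  have hne : ‖gammaFourier a y‖ ≠ 0 := fun h0 ↦ by
    rw [h0, zero_mul] at h; exact hΓ.ne h
  have e : ‖gammaFourier a y‖⁻¹ = ‖(1 + Complex.I * y : ℂ)‖ ^ a / Real.Gamma a := by
    rw [eq_div_iff hΓ.ne', ← h, inv_mul_cancel_left₀ hne]
  rw [e, div_mul_eq_mul_div]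
  gcongr

theorem gammaFourier_ne_zero {a : ℝ} (ha : 0 < a) (y : ℝ) : gammaFourier a y ≠ 0 := fun h0 ↦ by
  have h := norm_gammaFourier_mul ha y
  rw [h0, norm_zero, zero_mul] at h
  exact (Real.Gamma_pos_of_pos ha).ne h

theorem continuous_gammaFourier {a : ℝ} (ha : 0 < a) : Continuous (gammaFourier a) :=
  continuous_iff_continuousAt.2 fun y ↦ (hasDerivAt_gammaFourier ha y).continuousAt

/-- The threshold `1/2` is that of integrability of `t^(2(a-1))` at `0`. -/
theorem memLp_two_gammaKernel {a : ℝ} (ha : 1 / 2 < a) :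
    MemLp ((Ioi 0).indicator fun t ↦ (gammaKernel a t : ℂ)) 2 (volume : Measure ℝ) := by
  have hm : AEStronglyMeasurable (fun t ↦ (gammaKernel a t : ℂ)) (volume.restrict (Ioi (0 : ℝ))) :=
    (Complex.measurable_ofReal.comp (measurable_gammaKernel a)).aestronglyMeasurable
  rw [memLp_indicator_iff_restrict measurableSet_Ioi, memLp_two_iff_integrable_sq_norm hm]
  have h := integrableOn_rpow_mul_exp_neg_mul_rpow (p := 1) (s := 2 * (a - 1)) (b := 2)
    (by linarith) one_pos two_pos
  refine h.congr_fun (fun t ht ↦ ?_) measurableSet_Ioi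
  have ht' : (0 : ℝ) < t := ht
  simp only [Complex.norm_real, Real.norm_of_nonneg (gammaKernel_nonneg a ht'), Real.rpow_one]
  rw [gammaKernel, mul_pow, ← Real.exp_nat_mul, ← Real.rpow_natCast (t ^ (a - 1)),
    ← Real.rpow_mul ht'.le]
  rw [mul_comm]
  push_cast
  congr 2 <;> ring

/-! ### Continuity of the Fourier transform in the first frequency -/

/-- Translation acts continuously on `L²`, and pairing with `m` is continuous. -/
theorem continuous_integral_mul_translate {m k : ℝ → ℂ} (hm : MemLp m 2 volume)
    (hk : MemLp k 2 volume) : Continuous fun ξ : ℝ ↦ ∫ t, m t * k (ξ + t) := by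
  have : Fact ((2 : ℝ≥0∞) ≠ ∞) := ⟨ENNReal.ofNat_ne_top⟩
  have h : Continuous fun ξ : ℝ ↦ (DomAddAct.mk ξ +ᵥ hk.toLp : Lp ℂ 2 (volume : Measure ℝ)) :=
    DomAddAct.continuous_mk.vadd continuous_const
  have h2 : Continuous fun ξ : ℝ ↦ (ContinuousLinearMap.mul ℂ ℂ).lpPairing volume 2 2 hm.toLp
      (DomAddAct.mk ξ +ᵥ hk.toLp) :=
    (((ContinuousLinearMap.mul ℂ ℂ).lpPairing volume 2 2) hm.toLp).continuous.comp h
  refine h2.congr fun ξ ↦ ?_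
  rw [ContinuousLinearMap.lpPairing_eq_integral]
  refine integral_congr_ae ?_
  rw [DomAddAct.mk_vadd_toLp]
  filter_upwards [hm.coeFn_toLp, (hk.comp_measurePreserving
    (measurePreserving_vadd ξ (volume : Measure ℝ))).coeFn_toLp] with t h1 h3
  rw [h1]
  simp only [ContinuousLinearMap.mul_apply']
  congr 1

/-- The average of translates of `K` in the first variable against the gamma density. -/
def gammaAverage (a : ℝ) (K : Plane → ℂ) (ξ η : ℝ) : ℂ :=
  ∫ t in Ioi 0, (gammaKernel a t : ℂ) * K (xy.symm (ξ + t, η))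

/-- By Tonelli almost every horizontal slice of `K` is in `L²`, and on it the average pairs two `L²`
functions. -/
theorem continuous_gammaAverage {a : ℝ} (ha : 1 / 2 < a) {K : Plane → ℂ} (hKm : Measurable K)
    (hK : MemLp K 2 volume) : ∀ᵐ η : ℝ, Continuous fun ξ ↦ gammaAverage a K ξ η := by
  have hKe : Measurable fun ζ ↦ ‖K ζ‖ₑ ^ 2 := hKm.enorm.pow_const 2
  have hfin : ∫⁻ η : ℝ, ∫⁻ ξ : ℝ, ‖K (xy.symm (ξ, η))‖ₑ ^ 2 ≠ ∞ := by
    rw [← lintegral_plane hKe, lintegral_enorm_sq_eq_eLpNorm_sq]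
    exact ENNReal.pow_ne_top hK.2.ne
  have hsec : Measurable fun q : ℝ × ℝ ↦ ‖K (xy.symm (q.2, q.1))‖ₑ ^ 2 :=
    hKe.comp (xy.symm.measurable.comp (by fun_prop))
  have hae := ae_lt_top (Measurable.lintegral_prod_right' hsec) hfin
  filter_upwards [hae] with η hη
  have hk : MemLp (fun ξ ↦ K (xy.symm (ξ, η))) 2 volume := by
    refine ⟨(hKm.comp (xy.symm.measurable.comp (by fun_prop))).aestronglyMeasurable, ?_⟩
    have e := eLpNorm_nnreal_pow_eq_lintegral (f := fun ξ ↦ K (xy.symm (ξ, η)))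
      (μ := volume) (p := 2) two_ne_zero
    simp only [NNReal.coe_ofNat, ENNReal.rpow_ofNat, ENNReal.coe_ofNat] at e
    by_contra htop
    rw [not_lt, top_le_iff] at htop
    rw [htop] at e
    simp only [← e] at hη
    simp at hη
  refine (continuous_integral_mul_translate (memLp_two_gammaKernel ha) hk).congr fun ξ ↦ ?_
  rw [gammaAverage, ← integral_indicator measurableSet_Ioi]
  refine integral_congr_ae (Eventually.of_forall fun t ↦ ?_)
  by_cases ht : t ∈ Ioi (0 : ℝ) <;> simp [ht]

theorem xy_symm_coords (ζ : Plane) (t : ℝ) : xy.symm (ζ 0 + t, ζ 1) = ζ + t • ex := by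
  apply xy.injective
  simp [xy_apply]

/-- Bounding `|φ K|` by `|φ|² + |K|²` and using translation invariance gives a bound in `ζ` uniform
in `t`; the kernel supplies integrability in `t`. -/
theorem integrable_gammaKernel_mul_translate {a : ℝ} (ha : 0 < a) {K : Plane → ℂ}
    (hKm : Measurable K) (hK : MemLp K 2 volume) {φ : Plane → ℂ} (hφ : Continuous φ)
    (hφc : HasCompactSupport φ) :
    Integrable (fun p : ℝ × Plane ↦ (gammaKernel a p.1 : ℂ) * (φ p.2 * K (p.2 + p.1 • ex)))
      ((volume.restrict (Ioi 0)).prod volume) := by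
  have hmeas : Measurable fun p : ℝ × Plane ↦
      (gammaKernel a p.1 : ℂ) * (φ p.2 * K (p.2 + p.1 • ex)) := by
    have h1 := measurable_gammaKernel a
    have h2 := hφ.measurable
    fun_prop
  have hφ2 : MemLp φ 2 volume := hφ.memLp_of_hasCompactSupport hφc
  have htr : ∀ t : ℝ, MemLp (fun ζ ↦ K (ζ + t • ex)) 2 volume := fun t ↦
    hK.comp_measurePreserving (measurePreserving_add_right _ _)
  rw [integrable_prod_iff hmeas.aestronglyMeasurable]
  refine ⟨Eventually.of_forall fun t ↦
    Integrable.const_mul (f := fun ζ ↦ φ ζ * K (ζ + t • ex)) (hφ2.integrable_mul (htr t))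
      (gammaKernel a t : ℂ), ?_⟩
  have hsq : ∀ t : ℝ, ∫ ζ, ‖K (ζ + t • ex)‖ ^ 2 = ∫ ζ, ‖K ζ‖ ^ 2 := fun t ↦
    integral_add_right_eq_self (fun ζ ↦ ‖K ζ‖ ^ 2) _
  have hφi := (memLp_two_iff_integrable_sq_norm hφ2.1).1 hφ2
  refine ((integrableOn_gammaKernel ha).mul_const
    ((∫ ζ, ‖φ ζ‖ ^ 2) + ∫ ζ, ‖K ζ‖ ^ 2)).mono' ?_ ?_
  · exact hmeas.norm.aestronglyMeasurable.integral_prod_right'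
  filter_upwards [ae_restrict_mem measurableSet_Ioi] with t ht
  have hKi := (memLp_two_iff_integrable_sq_norm (htr t).1).1 (htr t)
  simp only [norm_mul, Complex.norm_real, Real.norm_of_nonneg (gammaKernel_nonneg a ht)]
  rw [integral_const_mul, norm_mul, Real.norm_of_nonneg (gammaKernel_nonneg a ht)]
  refine mul_le_mul_of_nonneg_left ?_ (gammaKernel_nonneg a ht)
  rw [Real.norm_of_nonneg (integral_nonneg fun ζ ↦ by positivity), ← hsq t,
    ← integral_add hφi hKi]
  refine integral_mono_of_nonneg (Eventually.of_forall fun ζ ↦ by positivity) (hφi.add hKi)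
    (Eventually.of_forall fun ζ ↦ ?_)
  beta_reduce
  nlinarith [sq_nonneg (‖φ ζ‖ - ‖K (ζ + t • ex)‖), norm_nonneg (φ ζ), norm_nonneg (K (ζ + t • ex))]

theorem integral_mul_gammaAverage {a : ℝ} (ha : 0 < a) {K : Plane → ℂ}
    (hKm : Measurable K) (hK : MemLp K 2 volume) {φ : Plane → ℂ} (hφ : Continuous φ)
    (hφc : HasCompactSupport φ) :
    Integrable (fun ζ ↦ φ ζ * gammaAverage a K (ζ 0) (ζ 1)) ∧
    ∫ ζ, φ ζ * gammaAverage a K (ζ 0) (ζ 1)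
      = ∫ t in Ioi 0, (gammaKernel a t : ℂ) * ∫ ζ, φ ζ * K (ζ + t • ex) := by
  have h := integrable_gammaKernel_mul_translate ha hKm hK hφ hφc
  have e : ∀ ζ : Plane, ∫ t in Ioi 0, (gammaKernel a t : ℂ) * (φ ζ * K (ζ + t • ex))
      = φ ζ * gammaAverage a K (ζ 0) (ζ 1) := fun ζ ↦ by
    rw [gammaAverage, ← integral_const_mul]
    refine integral_congr_ae (Eventually.of_forall fun t ↦ ?_)
    simp only [xy_symm_coords]; ring
  refine ⟨h.integral_prod_right.congr (Eventually.of_forall e), ?_⟩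
  simp only [← e]
  rw [← integral_integral_swap h]
  simp only [integral_const_mul]

theorem locallyIntegrable_gammaAverage {a : ℝ} (ha : 0 < a) {K : Plane → ℂ}
    (hKm : Measurable K) (hK : MemLp K 2 volume) :
    LocallyIntegrable fun ζ : Plane ↦ gammaAverage a K (ζ 0) (ζ 1) := by
  rw [locallyIntegrable_iff]
  intro C hC
  obtain ⟨φ, hφ1, _, hφc, _⟩ := exists_continuous_one_zero_of_isCompact hC isClosed_empty
    (disjoint_empty C)
  have h := (integral_mul_gammaAverage ha hKm hK (φ := fun ζ ↦ (φ ζ : ℂ)) (by fun_prop)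
    (hφc.comp_left (g := ((↑) : ℝ → ℂ)) rfl)).1
  refine (h.integrableOn (s := C)).congr_fun (fun ζ hζ ↦ ?_) hC.measurableSet
  simp [hφ1 hζ]

/-- Multiplication by `gammaFourier a (2πx)` superposes the modulations `exp (-2πitx)`, each of
which translates `𝓕 k` by `t` in `ξ`. Duality and Fubini make this precise. -/
theorem fourier_eq_gammaAverage {a : ℝ} (ha : 0 < a) {f k : L2}
    (hk : ∀ᵐ z : Plane, f z = gammaFourier a (2 * Real.pi * z 0) * k z) {K : Plane → ℂ}
    (hKm : Measurable K) (hK : (𝓕 k : L2) =ᵐ[volume] K) :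
    ∀ᵐ ζ : Plane, (𝓕 f : L2) ζ = gammaAverage a K (ζ 0) (ζ 1) := by
  have hKL : MemLp K 2 volume := (Lp.memLp (𝓕 k : L2)).ae_eq hK
  refine ae_eq_of_forall_integral_mul_eq (locallyIntegrable_L2 _)
    (locallyIntegrable_gammaAverage ha hKm hKL) fun φ hφc ↦ ?_
  rw [(integral_mul_gammaAverage ha hKm hKL φ.continuous hφc).2]
  have hmod : ∀ t : ℝ, ∫ ζ, φ ζ * K (ζ + t • ex)
      = ∫ z : Plane, Complex.exp (-(Complex.I * (t * (2 * Real.pi * z 0) : ℝ)))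
        * ((𝓕 φ) z * k z) := by
    intro t
    have hkt := (memLp_modulation k (-(t • ex))).coeFn_toLp
    have h1 := fourier_modulation k _ (-(t • ex)) hkt
    have hsh : ∀ᵐ ζ, (𝓕 k : L2) (ζ + t • ex) = K (ζ + t • ex) :=
      (measurePreserving_add_right _ _).quasiMeasurePreserving.ae hK
    calc ∫ ζ, φ ζ * K (ζ + t • ex)
        = ∫ ζ, φ ζ * (𝓕 (memLp_modulation k (-(t • ex))).toLp : L2) ζ := by
          refine integral_congr_ae ?_
          filter_upwards [h1, hsh] with ζ e1 e2
          rw [e1, sub_neg_eq_add, e2]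
      _ = _ := by
          rw [integral_mul_fourier]
          refine integral_congr_ae ?_
          filter_upwards [hkt] with z hz
          rw [hz, inner_neg_right, inner_smul_right, inner_ex]
          have : (2 * Real.pi * Complex.I * ((-(t * z 0) : ℝ) : ℂ))
              = -(Complex.I * (t * (2 * Real.pi * z 0) : ℝ)) := by
            push_cast; ring
          rw [this]
          ring
  simp only [hmod]
  have hprod : Integrable (fun z ↦ (𝓕 φ) z * k z) :=
    ((𝓕 φ).memLp 2).integrable_mul (Lp.memLp k)
  have hint : Integrable (fun p : ℝ × Plane ↦ (gammaKernel a p.1 : ℂ) *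
      (Complex.exp (-(Complex.I * (p.1 * (2 * Real.pi * p.2 0) : ℝ))) * ((𝓕 φ) p.2 * k p.2)))
      ((volume.restrict (Ioi 0)).prod volume) := by
    have h := ((integrableOn_gammaKernel ha).ofReal (𝕜 := ℂ)).mul_prod hprod
    have h2 := h.mul_bdd (c := 1)
      (g := fun p : ℝ × Plane ↦ Complex.exp (-(Complex.I * (p.1 * (2 * Real.pi * p.2 0) : ℝ))))
      (Continuous.aestronglyMeasurable (by fun_prop))
      (Eventually.of_forall fun p ↦ (norm_exp_neg_I_mul_real _).le)
    refine h2.congr (Eventually.of_forall fun p ↦ ?_)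
    simp only [Complex.coe_algebraMap]
    ring
  calc ∫ ζ, φ ζ * (𝓕 f : L2) ζ = ∫ z, (𝓕 φ) z * f z := integral_mul_fourier f φ
    _ = ∫ z : Plane, ∫ t in Ioi 0, (gammaKernel a t : ℂ) *
        (Complex.exp (-(Complex.I * (t * (2 * Real.pi * z 0) : ℝ))) * ((𝓕 φ) z * k z)) := by
        refine integral_congr_ae ?_
        filter_upwards [hk] with z hz
        rw [hz, gammaFourier, mul_left_comm, ← integral_mul_const]
        refine integral_congr_ae (Eventually.of_forall fun t ↦ ?_)
        beta_reduce
        ring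
    _ = _ := by
        rw [← integral_integral_swap hint]
        simp only [integral_const_mul]

/-- If `|x|^a f` is square integrable for some `a > 1/2`, then `𝓕 f` has a representative that is
continuous in `ξ` for almost every `η`. -/
theorem exists_continuous_representative {a : ℝ} (ha : 1 / 2 < a) {f : L2}
    (hf : MemLp (fun z : Plane ↦ (|z 0| ^ a : ℝ) • f z) 2 volume) :
    ∃ G : ℝ → ℝ → ℂ, (∀ᵐ ζ : Plane, (𝓕 f : L2) ζ = G (ζ 0) (ζ 1)) ∧
      ∀ᵐ η : ℝ, Continuous fun ξ ↦ G ξ η := by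
  have ha0 : 0 < a := by linarith
  -- This quotient plays the role of a fractional derivative of order `a` of `𝓕 f` in `ξ`.
  have hk : MemLp (fun z : Plane ↦ (gammaFourier a (2 * Real.pi * z 0))⁻¹ * f z) 2 volume := by
    have hcont : Continuous fun z : Plane ↦ (gammaFourier a (2 * Real.pi * z 0))⁻¹ :=
      ((continuous_gammaFourier ha0).comp (by fun_prop)).inv₀ fun z ↦ gammaFourier_ne_zero ha0 _
    have hsum : MemLp (fun z : Plane ↦ ‖f z‖ + ‖(|z 0| ^ a : ℝ) • f z‖) 2 volume :=
      (Lp.memLp f).norm.add hf.norm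
    refine MemLp.of_le_mul (c := 2 ^ a / Real.Gamma a * (1 + (2 * Real.pi) ^ a)) hsum
      (hcont.aestronglyMeasurable.mul (Lp.aestronglyMeasurable f))
      (Eventually.of_forall fun z ↦ ?_)
    have h := inv_norm_gammaFourier_le ha0 (2 * Real.pi * z 0)
    have hΓ := Real.Gamma_pos_of_pos ha0
    rw [abs_mul, abs_of_pos Real.two_pi_pos, Real.mul_rpow Real.two_pi_pos.le (abs_nonneg _)] at h
    have hz : 0 ≤ |z 0| ^ a := by positivity
    have h2π : 0 ≤ (2 * Real.pi) ^ a := by positivity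
    rw [norm_mul, norm_inv, norm_smul, Real.norm_of_nonneg hz,
      Real.norm_of_nonneg (add_nonneg (norm_nonneg _) (mul_nonneg hz (norm_nonneg _)))]
    have h1 : (1 + (2 * Real.pi) ^ a * |z 0| ^ a) * ‖f z‖
        ≤ (1 + (2 * Real.pi) ^ a) * (‖f z‖ + |z 0| ^ a * ‖f z‖) := by
      nlinarith [mul_nonneg hz (norm_nonneg (f z)), mul_nonneg h2π (norm_nonneg (f z))]
    calc _ ≤ 2 ^ a / Real.Gamma a * (1 + (2 * Real.pi) ^ a * |z 0| ^ a) * ‖f z‖ := by gcongr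
      _ = 2 ^ a / Real.Gamma a * ((1 + (2 * Real.pi) ^ a * |z 0| ^ a) * ‖f z‖) := by ring
      _ ≤ 2 ^ a / Real.Gamma a * ((1 + (2 * Real.pi) ^ a) * (‖f z‖ + |z 0| ^ a * ‖f z‖)) := by
          gcongr
      _ = _ := by ring
  have hKm := (Lp.stronglyMeasurable (𝓕 hk.toLp : L2)).measurable
  refine ⟨gammaAverage a (𝓕 hk.toLp : L2), fourier_eq_gammaAverage ha0 (k := hk.toLp) ?_ hKm
    (ae_eq_refl _), continuous_gammaAverage ha hKm (Lp.memLp _)⟩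
  filter_upwards [hk.coeFn_toLp] with z hz
  rw [hz, mul_inv_cancel_left₀ (gammaFourier_ne_zero ha0 _)]

/-! ### Weighted and Sobolev norms -/

theorem enorm_le_sobolevENorm {s : ℝ} (hs : 0 ≤ s) (f : L2) : ‖f‖ₑ ≤ sobolevENorm s f := by
  rw [← ofReal_norm, ← Lp.norm_fourier_eq f, ofReal_norm, Lp.enorm_def, sobolevENorm]
  refine eLpNorm_mono fun ζ ↦ ?_
  rw [norm_smul]
  refine le_mul_of_one_le_left (norm_nonneg _) ?_
  rw [Real.norm_of_nonneg (by positivity)]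
  exact Real.one_le_rpow (by nlinarith [sq_nonneg ‖ζ‖]) (by linarith)

theorem ContinuousInZ.continuousOn {s r₁ r₂ T : ℝ} (hs : 0 ≤ s) {u : ℝ → L2}
    (h : ContinuousInZ s r₁ r₂ T u) : ContinuousOn u (Icc 0 T) := by
  intro t₀ ht₀
  rw [ContinuousWithinAt, tendsto_iff_edist_tendsto_0]
  refine tendsto_of_tendsto_of_tendsto_of_le_of_le tendsto_const_nhds (h.2 t₀ ht₀)
    (fun _ ↦ zero_le) fun t ↦ ?_
  simp only [edist_eq_enorm_sub, zENorm]
  exact (enorm_le_sobolevENorm hs _).trans le_self_add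

theorem MemZ.memLp {s a r₂ : ℝ} {f : L2} (h : MemZ s a r₂ f) :
    MemLp (fun z : Plane ↦ (|z 0| ^ a : ℝ) • f z) 2 volume := by
  have hm : Measurable fun z : Plane ↦ (|z 0| ^ a : ℝ) := by fun_prop
  refine ⟨hm.aestronglyMeasurable.smul (Lp.aestronglyMeasurable f), lt_of_le_of_lt ?_
    (lt_of_le_of_lt le_add_self h)⟩
  refine eLpNorm_mono fun z ↦ ?_
  rw [norm_smul, norm_smul]
  refine mul_le_mul_of_nonneg_right ?_ (norm_nonneg _)
  rw [Real.norm_of_nonneg (by positivity), Real.norm_of_nonneg (by positivity)]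
  refine Real.le_sqrt_of_sq_le ?_
  rw [← Real.rpow_natCast, ← Real.rpow_mul (abs_nonneg _), mul_comm a]
  push_cast
  linarith [Real.rpow_nonneg (abs_nonneg (z 1)) (2 * r₂)]

theorem MemZ.lintegral_ne_top {s r₂ : ℝ} {f : L2} (h : MemZ s (1 / 2) r₂ f) :
    ∫⁻ z : Plane, ‖z 0‖ₑ * ‖f z‖ₑ ^ 2 ≠ ∞ := by
  have e : ∀ z : Plane, ‖z 0‖ₑ * ‖f z‖ₑ ^ 2 = ‖(|z 0| ^ (1 / 2 : ℝ) : ℝ) • f z‖ₑ ^ 2 := by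
    intro z
    rw [enorm_smul, mul_pow, ← Real.sqrt_eq_rpow, ← enorm_pow (√|z 0|), Real.sq_sqrt (abs_nonneg _),
      ← Real.norm_eq_abs, enorm_norm]
  simp only [e]
  rw [lintegral_enorm_sq_eq_eLpNorm_sq]
  exact ENNReal.pow_ne_top h.memLp.2.ne

/-! ### One-sided limits of the Duhamel formula -/

/-- The right-hand side of Duhamel's formula, with the sign of `ξ` replaced by `c`. -/
def duhamelBranch (σ : ℝ) (q : ℝ → Plane →ᵇ ℂ) (t₁ t : ℝ) (G : ℝ → ℝ → ℂ) (c ξ η : ℝ) : ℂ :=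
  Complex.exp (Complex.I * ((t - t₁) *
      (c * (1 + 4 * Real.pi ^ 2 * ξ ^ 2 - 4 * Real.pi ^ 2 * σ * η ^ 2)) : ℝ)) * G ξ η
    - Real.pi * Complex.I * ξ * ∫ τ in t₁..t, Complex.exp (Complex.I * ((t - τ) *
      (c * (1 + 4 * Real.pi ^ 2 * ξ ^ 2 - 4 * Real.pi ^ 2 * σ * η ^ 2)) : ℝ))
        * q τ (xy.symm (ξ, η))

section branch

variable {σ t₁ t : ℝ} {q : ℝ → Plane →ᵇ ℂ} {G : ℝ → ℝ → ℂ} {η : ℝ}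

theorem duhamelBranch_zero (c : ℝ) : duhamelBranch σ q t₁ t G c 0 η
    = Complex.exp (Complex.I * ((t - t₁) * (c * (1 - 4 * Real.pi ^ 2 * σ * η ^ 2)) : ℝ))
      * G 0 η := by
  simp [duhamelBranch]

/-- Freezing the sign at `c` removes the only discontinuity in `ξ`, so each one-sided limit at `0`
is a value of a continuous branch. -/
theorem continuous_duhamelBranch (hq : Continuous q) (hG : Continuous fun ξ ↦ G ξ η) (c : ℝ) :
    Continuous fun ξ ↦ duhamelBranch σ q t₁ t G c ξ η := by
  have hxy : Continuous fun p : ℝ × ℝ ↦ (xy.symm (p.1, η) : Plane) := by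
    have : (fun p : ℝ × ℝ ↦ (xy.symm (p.1, η) : Plane)) = fun p ↦ !₂[p.1, η] := by
      funext p
      apply xy.injective
      simp [xy_apply]
    rw [this]
    fun_prop
  refine Continuous.sub (Continuous.mul (by fun_prop) hG) (Continuous.mul (by fun_prop) ?_)
  refine intervalIntegral.continuous_parametric_intervalIntegral_of_continuous'
    (f := fun ξ τ ↦ Complex.exp (Complex.I * ((t - τ) *
      (c * (1 + 4 * Real.pi ^ 2 * ξ ^ 2 - 4 * Real.pi ^ 2 * σ * η ^ 2)) : ℝ))
        * q τ (xy.symm (ξ, η))) ?_ _ _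
  unfold Function.uncurry
  fun_prop

theorem tendsto_duhamelBranch_sign_right (hq : Continuous q) (hG : Continuous fun ξ ↦ G ξ η) :
    Tendsto (fun ξ ↦ duhamelBranch σ q t₁ t G (SignType.sign ξ : ℝ) ξ η) (𝓝[>] 0)
      (𝓝 (duhamelBranch σ q t₁ t G 1 0 η)) := by
  refine (((continuous_duhamelBranch hq hG 1).tendsto 0).mono_left nhdsWithin_le_nhds).congr' ?_
  filter_upwards [self_mem_nhdsWithin] with ξ hξ
  rw [sign_pos hξ]
  simp

theorem tendsto_duhamelBranch_sign_left (hq : Continuous q) (hG : Continuous fun ξ ↦ G ξ η) :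
    Tendsto (fun ξ ↦ duhamelBranch σ q t₁ t G (SignType.sign ξ : ℝ) ξ η) (𝓝[<] 0)
      (𝓝 (duhamelBranch σ q t₁ t G (-1) 0 η)) := by
  refine (((continuous_duhamelBranch hq hG (-1)).tendsto 0).mono_left nhdsWithin_le_nhds).congr' ?_
  filter_upwards [self_mem_nhdsWithin] with ξ hξ
  rw [sign_neg hξ]
  simp

/-- The branches `c = -1` and `c = 1` agree at `ξ = 0`: both vanish there with `G 0 η`. -/
theorem continuous_duhamelBranch_sign (hq : Continuous q) (hG : Continuous fun ξ ↦ G ξ η)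
    (h0 : G 0 η = 0) :
    Continuous fun ξ ↦ duhamelBranch σ q t₁ t G (SignType.sign ξ : ℝ) ξ η := by
  have e : (fun ξ ↦ duhamelBranch σ q t₁ t G (SignType.sign ξ : ℝ) ξ η)
      = fun ξ ↦ if ξ ≤ 0 then duhamelBranch σ q t₁ t G (-1) ξ η
        else duhamelBranch σ q t₁ t G 1 ξ η := by
    funext ξ
    rcases lt_trichotomy ξ 0 with h | rfl | h
    · simp [h.le, sign_neg h]
    · simp [duhamelBranch_zero, h0]
    · simp [h.not_ge, sign_pos h]
  rw [e]
  refine Continuous.if_le (continuous_duhamelBranch hq hG _) (continuous_duhamelBranch hq hG _)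
    continuous_id continuous_const ?_
  rintro ξ rfl
  simp [duhamelBranch_zero, h0]

end branch

theorem ae_sin_ne_zero {σ d : ℝ} (hσ : σ ≠ 0) (hd : d ≠ 0) :
    ∀ᵐ η : ℝ, Real.sin (d * (1 - 4 * Real.pi ^ 2 * σ * η ^ 2)) ≠ 0 := by
  have hcount : {η : ℝ | Real.sin (d * (1 - 4 * Real.pi ^ 2 * σ * η ^ 2)) = 0}.Countable := by
    have hsub : {η : ℝ | Real.sin (d * (1 - 4 * Real.pi ^ 2 * σ * η ^ 2)) = 0}
        ⊆ ⋃ n : ℤ, {η : ℝ | n * Real.pi = d * (1 - 4 * Real.pi ^ 2 * σ * η ^ 2)} := by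
      intro η hη
      obtain ⟨n, hn⟩ := Real.sin_eq_zero_iff.1 hη
      exact mem_iUnion.2 ⟨n, hn⟩
    -- Each multiple of `π` is attained by at most two values `±x`, as `d` and `σ` are nonzero.
    refine (countable_iUnion fun n ↦ ?_).mono hsub
    rcases eq_empty_or_nonempty
      {η : ℝ | (n : ℝ) * Real.pi = d * (1 - 4 * Real.pi ^ 2 * σ * η ^ 2)} with h | ⟨x, hx⟩
    · rw [h]; exact countable_empty
    · refine ((Set.toFinite {x, -x}).subset fun y hy ↦ ?_).countable
      have h1 := mul_left_cancel₀ hd ((mem_ofPred.1 hx).symm.trans (mem_ofPred.1 hy))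
      have h2 : 4 * Real.pi ^ 2 * σ ≠ 0 := by positivity
      have h3 : y ^ 2 = x ^ 2 := mul_left_cancel₀ h2 (by linarith)
      simpa using sq_eq_sq_iff_eq_or_eq_neg.1 h3
  have := hcount.ae_notMem volume
  filter_upwards [this] with η hη using hη

theorem eq_zero_of_exp_mul_eq {θ : ℝ} (hθ : Real.sin θ ≠ 0) {g : ℂ}
    (h : Complex.exp (Complex.I * (θ : ℝ)) * g = Complex.exp (Complex.I * ((-θ : ℝ) : ℂ)) * g) :
    g = 0 := by
  have e : Complex.exp (Complex.I * (θ : ℝ)) - Complex.exp (Complex.I * ((-θ : ℝ) : ℂ))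
      = 2 * Complex.I * (Real.sin θ : ℂ) := by
    rw [mul_comm Complex.I, mul_comm Complex.I, Complex.exp_mul_I, Complex.exp_mul_I]
    push_cast
    rw [Complex.cos_neg, Complex.sin_neg]
    ring
  have h2 : 2 * Complex.I * (Real.sin θ : ℂ) * g = 0 := by
    rw [← e, sub_mul, h, sub_self]
  have h3 : (2 * Complex.I * (Real.sin θ : ℂ)) ≠ 0 :=
    mul_ne_zero (by simp) (Complex.ofReal_ne_zero.2 hθ)
  exact (mul_eq_zero.1 h2).resolve_left h3

theorem fourierVanishesAtZero_of_memZ {σ s r₁ r₂ r₂' T : ℝ} (hσ : σ ≠ 0) (hs : 0 ≤ s)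
    {u : ℝ → L2} (hsol : IsSolution σ T u) (hcont : ContinuousInZ s r₁ r₂ T u)
    {t₁ t₂ ε : ℝ} (ht₁ : 0 ≤ t₁) (hε : 0 < ε) (h₁ : MemZ s (1 / 2 + ε) r₂ (u t₁))
    (ht₂ : t₂ ∈ Ioc t₁ T) (h₂ : MemZ s (1 / 2) r₂' (u t₂)) {t : ℝ} (ht : t ∈ Icc t₁ T) :
    FourierVanishesAtZero (u t) := by
  have hu := hcont.continuousOn hs
  have h0T : (0 : ℝ) ≤ T := ht₁.trans (ht₂.1.le.trans ht₂.2)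
  -- Extending `u` by its endpoint values makes `q` continuous on all of `ℝ`.
  set q : ℝ → Plane →ᵇ ℂ := fun τ ↦ squareHat (IccExtend h0T ((Icc 0 T).domRestrict u) τ)
  have hq : Continuous q :=
    continuous_squareHat.comp (continuousOn_iff_continuous_domRestrict.1 hu).Icc_extend'
  have hqu : ∀ τ ∈ Icc 0 T, q τ = squareHat (u τ) := fun τ hτ ↦ by
    simp only [q]
    rw [IccExtend_of_mem h0T _ hτ, domRestrict_apply]
  obtain ⟨G, hG, hGc⟩ := exists_continuous_representative (by linarith) h₁.memLp
  have hrep : ∀ t ∈ Icc t₁ T, ∀ᵐ ζ : Plane, (𝓕 (u t) : L2) ζ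
      = duhamelBranch σ q t₁ t G (SignType.sign (ζ 0) : ℝ) (ζ 0) (ζ 1) := by
    intro t ht
    filter_upwards [duhamel hsol hu hq hqu ht₁ ht.1 ht.2, hG] with ζ e1 e2
    rw [e1, e2]
    have e3 : xy.symm (ζ 0, ζ 1) = ζ := xy.symm_apply_apply ζ
    simp only [duhamelBranch, dispersion, e3]
  have hjump := ae_eq_of_tendsto_fourier h₂.lintegral_ne_top
    (G := fun ξ η ↦ duhamelBranch σ q t₁ t₂ G (SignType.sign ξ : ℝ) ξ η)
    (hrep t₂ ⟨ht₂.1.le, ht₂.2⟩) (hGc.mono fun η h ↦ tendsto_duhamelBranch_sign_right hq h)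
    (hGc.mono fun η h ↦ tendsto_duhamelBranch_sign_left hq h)
  -- The absence of a jump at `t₂` reads `exp (iθ) G(0, η) = exp (-iθ) G(0, η)`, and `sin θ ≠ 0` for
  -- almost every `η`.
  have hG0 : ∀ᵐ η : ℝ, G 0 η = 0 := by
    filter_upwards [hjump, ae_sin_ne_zero hσ (sub_pos.2 ht₂.1).ne'] with η h1 h2
    simp only [duhamelBranch_zero, one_mul, neg_one_mul, mul_neg] at h1
    exact eq_zero_of_exp_mul_eq h2 h1
  refine ⟨fun ξ η ↦ duhamelBranch σ q t₁ t G (SignType.sign ξ : ℝ) ξ η, hrep t ht, ?_⟩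
  filter_upwards [hGc, hG0] with η h1 h2
  exact ⟨continuous_duhamelBranch_sign hq h1 h2, by simp [duhamelBranch_zero, h2]⟩

end

end CapillaryGravity

theorem mainTheorem6
    (σ : ℝ) (hσ : σ = 1 ∨ σ = -1)
    (s r₁ r₂ T : ℝ) (hr₁ : r₁ ∈ Set.Ioo (1 / 4 : ℝ) (1 / 2)) (hr₂ : r₁ ≤ r₂)
    (hs₁ : 2 * r₁ / (4 * r₁ - 1) < s) (hs₂ : r₂ ≤ s)
    (u : ℝ → CapillaryGravity.L2)
    (hsol : CapillaryGravity.IsSolution σ T u)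
    (hcont : CapillaryGravity.ContinuousInZ s r₁ r₂ T u)
    (hW : CapillaryGravity.MemL1W T u)
    (t₁ : ℝ) (ht₁ : t₁ ∈ Set.Icc 0 T)
    (hdecay : ∃ ε : ℝ, 0 < ε ∧ CapillaryGravity.MemZ s (1 / 2 + ε) r₂ (u t₁)) :
    (∀ t₂ ∈ Set.Ioc t₁ T, CapillaryGravity.MemZ s (1 / 2) r₂ (u t₂) →
      ∀ t ∈ Set.Icc t₁ T, CapillaryGravity.FourierVanishesAtZero (u t)) ∧
    (¬ CapillaryGravity.FourierVanishesAtZero (u t₁) →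
      ∀ t₂ ∈ Set.Ioc t₁ T, ¬ CapillaryGravity.MemZ s (1 / 2) r₂ (u t₂)) := by
  have hs : 0 ≤ s := by
    refine le_trans (div_nonneg ?_ ?_) hs₁.le <;> linarith [hr₁.1]
  have hσ0 : σ ≠ 0 := by rcases hσ with rfl | rfl <;> norm_num
  obtain ⟨ε, hε, h₁⟩ := hdecay
  have main : ∀ t₂ ∈ Set.Ioc t₁ T, CapillaryGravity.MemZ s (1 / 2) r₂ (u t₂) →
      ∀ t ∈ Set.Icc t₁ T, CapillaryGravity.FourierVanishesAtZero (u t) := fun t₂ ht₂ h₂ t ht ↦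
    CapillaryGravity.fourierVanishesAtZero_of_memZ hσ0 hs hsol hcont ht₁.1 hε h₁ ht₂ h₂ ht
  -- The second claim is the contrapositive of the first at `t = t₁`.
  exact ⟨main, fun hnot t₂ ht₂ h₂ ↦ hnot (main t₂ ht₂ h₂ t₁ ⟨le_rfl, ht₁.2⟩)⟩
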